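/- For a group $G$ and $x_1,\dots,x_\ell\in G$ write $[x,y]=x^{-1}y^{-1}xy$ and $[x_1,\dots,x_\ell]=[\dots[[x_1,x_2],x_3],\dots,x_\ell]$ (for $\ell=1$ this is $x_1$); elements of this form are called commutators of length $\ell$ of $G$. Let $\gamma_\ell(G)$ denote the $\ell$-th term of the lower central series of $G$, where $\gamma_1(G)=G$ and $\gamma_{i+1}(G)=[\gamma_i(G),G]$. There are functions $f,g:\mathbb N^3\to\mathbb N$ with the following property. Let $\ell,m,n,r$ be positive integers and let $G$ be a group that can be generated by $r$ elements. Suppose that $n$ is the maximal order of a commutator of length $\ell$ of $G$ (that is, every commutator of length $\ell$ of $G$ has finite order at most $n$, and some commutator of length $\ell$ has order $n$), and that at most $m$ commutators of length $\ell$ of $G$ have order $n$. Suppose moreover that one of the following holds: - $n=p^{\alpha}$ for some prime $p$ and integer $\alpha\ge 0$; - $n=p^{\alpha}q^{\beta}$ for some odd primes $p,q$ and integers $\alpha,\beta\ge 1$; - $G$ is nilpotent. Then $\gamma_\ell(G)$ is finite with $|\gamma_\ell(G)|\le f(m,\ell,r)$, and there is a subgroup $M\le G$ of finite index $|G:M|\le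 g(m,\ell,r)$ such that $\gamma_\ell(M)=1$. -/

import Mathlib

namespace MaxOrderCommutators

variable {G : Type*} [Group G]

/-- The commutator `[x, y] = x⁻¹ y⁻¹ x y`. -/
def comm₂ (x y : G) : G := x⁻¹ * y⁻¹ * x * y

/-- The left-normed commutator `[x₁, x₂, …, x_ℓ] = [… [[x₁, x₂], x₃], …, x_ℓ]` of a list
`x₁, …, x_ℓ`; for `ℓ = 1` it is `x₁`. (The empty list is given the value `1`.) -/
def leftNormedComm : List G → G
  | [] => 1
  | x :: xs => xs.foldl comm₂ x

variable (G) in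
/-- The set of all commutators of length `ℓ` of the group `G`. -/
def commutatorsOfLength (ℓ : ℕ) : Set G :=
  {g | ∃ xs : List G, xs.length = ℓ ∧ leftNormedComm xs = g}

variable (G) in
/-- The positive integer `n` is the maximal order of a commutator of length `ℓ` of `G`: every
commutator of length `ℓ` has finite order at most `n`, and some such commutator has order `n`. -/
def IsMaximalCommutatorOrder (ℓ n : ℕ) : Prop :=
  (∀ g ∈ commutatorsOfLength G ℓ, IsOfFinOrder g ∧ orderOf g ≤ n) ∧
    ∃ g ∈ commutatorsOfLength G ℓ, orderOf g = n

variable (G) in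
/-- The set of all commutators of length `ℓ` of `G` that have order `n`. -/
def commutatorsOfOrder (ℓ n : ℕ) : Set G :=
  {g ∈ commutatorsOfLength G ℓ | orderOf g = n}

variable (G) in
/-- `G` can be generated by `r` elements (repetitions allowed). -/
def IsGeneratedBy (r : ℕ) : Prop :=
  ∃ f : Fin r → G, Subgroup.closure (Set.range f) = ⊤

/-- The term `γ_ℓ(H)`, `ℓ ≥ 1`, of the lower central series of the subgroup `H`, where
`γ_1(H) = H` and `γ_{i+1}(H) = [γ_i(H), H]`. (Mathlib numbers this series from `0`.) -/
def gamma (ℓ : ℕ) (H : Subgroup G) : Subgroup G := H.lowerCentralSeries (ℓ - 1)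

end MaxOrderCommutators

namespace MaxOrderCommutators

/-! Let `X` be the set of commutators of length `ℓ` of maximal order `n`, and fix `x = [x₁,…,x_ℓ]`
in `X`. Since `X` is finite and normal, its centralizer `C` has bounded index. Suppose one entry of
`x` is multiplied by an element of a normal subgroup `D ≤ C`, at a stage where later entries may
already move in their cosets of `D` without changing `x`. The value becomes `t x`, where `t ∈ D`
commutes with `x`, and `t`, `t x` and `t⁻¹ x` are all commutators of length `ℓ`. If `n` is a prime
power, or a product of powers of two odd primes, one of these three has order `n` and so lies in `X`
(`OrderAlternative`). Hence `t` takes at most `3m` values.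

Few values centralised by `D` force triviality on a smaller subgroup. Iterated commutators become
homomorphic in each entry, and a homomorphism with central image and at most `N` values kills
commutators and `N!`-th powers. Such verbal subgroups have bounded index because `G` has `r`
generators. Freeing the entries from last to first (`coset_chain`) gives `D` of bounded index with
`[c,k₂,…,k_ℓ] = 1` for `c ∈ D` and all `kᵢ` in fixed cosets of `D`, and therefore `γ_ℓ(D) = 1`.

Thus `G` is finitely generated and virtually nilpotent, hence residually finite. In a finite group,
powers of commutators of length `ℓ` with exponent coprime to the group order are again such
commutators (`pow_mem_commutatorsOfLength`, by class sums in characteristic `p`). So `φ(n) ≤ m`,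
which bounds `n`, and the commutators have bounded exponent. A nilpotent group of bounded rank and
class has boundedly many elements of bounded exponent, so the coset argument can be repeated for
every commutator of length `ℓ`. There are then boundedly many of them, and Dietzmann's lemma bounds
`|γ_ℓ(G)|`.

For nilpotent `G`, residual finiteness reduces to finite `G`, a product of `p`-groups. Each factor
inherits the hypotheses with the same `m` and a prime power in place of `n`. Factors for primes
beyond the resulting bound have trivial `γ_ℓ`, and only boundedly many factors remain.

In all cases the subgroup `M` is obtained at the end from the bound on `|γ_ℓ(G)|`. -/

/-- Conjugation `y ↦ d⁻¹ y d`, as an endomorphism of the group. -/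
def cj {G : Type*} [Group G] (d : G) : G →* G := (MulAut.conj d⁻¹).toMonoidHom

/-! ### Commutator identities, twisted tails and stable elements -/

section Conjugation

variable {G : Type*} [Group G]

theorem cj_apply (d y : G) : cj d y = d⁻¹ * y * d := by simp [cj]

@[simp] theorem cj_one_left (y : G) : cj 1 y = y := by simp [cj_apply]

theorem cj_cj (d e y : G) : cj e (cj d y) = cj (d * e) y := by simp [cj_apply, mul_assoc]

@[simp] theorem cj_inv_cj (d y : G) : cj d⁻¹ (cj d y) = y := by simp [cj_cj]

@[simp] theorem cj_cj_inv (d y : G) : cj d (cj d⁻¹ y) = y := by simp [cj_cj]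

theorem cj_mem {D : Subgroup G} [hD : D.Normal] (d : G) {y : G} (hy : y ∈ D) : cj d y ∈ D := by
  have := hD.conj_mem y hy d⁻¹
  simpa [cj_apply] using this

theorem map_cj {K : Type*} [Group K] (f : G →* K) (d y : G) : f (cj d y) = cj (f d) (f y) := by
  simp [cj_apply]

theorem cj_eq_self_of_commute {d y : G} (h : d * y = y * d) : cj d y = y := by
  rw [cj_apply, mul_assoc, ← h, inv_mul_cancel_left]

theorem orderOf_cj (d y : G) : orderOf (cj d y) = orderOf y :=
  orderOf_injective (cj d) (MulAut.conj d⁻¹).injective y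

theorem map_comm₂ {K : Type*} [Group K] (f : G →* K) (x y : G) :
    f (comm₂ x y) = comm₂ (f x) (f y) := by
  simp [comm₂]

@[simp] theorem comm₂_one_left (x : G) : comm₂ 1 x = 1 := by simp [comm₂]

@[simp] theorem comm₂_one_right (x : G) : comm₂ x 1 = 1 := by simp [comm₂]

theorem comm₂_mul_right (x y z : G) : comm₂ x (y * z) = comm₂ x z * cj z (comm₂ x y) := by
  simp [comm₂, cj_apply, mul_assoc]

theorem comm₂_mul_left (x y z : G) : comm₂ (x * y) z = cj y (comm₂ x z) * comm₂ y z := by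
  simp [comm₂, cj_apply, mul_assoc]

theorem comm₂_mem_left {D : Subgroup G} [D.Normal] {x : G} (y : G) (hx : x ∈ D) :
    comm₂ x y ∈ D := by
  have : comm₂ x y = x⁻¹ * cj y x := by simp [comm₂, cj_apply, mul_assoc]
  rw [this]
  exact D.mul_mem (D.inv_mem hx) (cj_mem y hx)

theorem comm₂_mem_right {D : Subgroup G} [D.Normal] (x : G) {y : G} (hy : y ∈ D) :
    comm₂ x y ∈ D := by
  have : comm₂ x y = cj x y⁻¹ * y := by simp [comm₂, cj_apply, mul_assoc]
  rw [this]
  exact D.mul_mem (cj_mem x (D.inv_mem hy)) hy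

/-- The commutator `[… [[u, g₁], g₂], …, g_k]`. -/
def iterComm (g : List G) (u : G) : G := g.foldl comm₂ u

@[simp] theorem iterComm_nil (u : G) : iterComm [] u = u := rfl

@[simp] theorem iterComm_cons (z : G) (g : List G) (u : G) :
    iterComm (z :: g) u = iterComm g (comm₂ u z) := rfl

theorem iterComm_append (g h : List G) (u : G) :
    iterComm (g ++ h) u = iterComm h (iterComm g u) := List.foldl_append

theorem map_iterComm {K : Type*} [Group K] (f : G →* K) (g : List G) (u : G) :
    f (iterComm g u) = iterComm (g.map f) (f u) := by
  induction g generalizing u with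
  | nil => rfl
  | cons z g ih => simp [ih, map_comm₂]

@[simp] theorem iterComm_one (g : List G) : iterComm g (1 : G) = 1 := by
  induction g with
  | nil => rfl
  | cons z g ih => simp [ih]

theorem iterComm_cj (g : List G) (d u : G) :
    iterComm g (cj d u) = cj d (iterComm (g.map (cj d⁻¹)) u) := by
  rw [map_iterComm, List.map_map]
  congr 1
  conv_lhs => rw [← List.map_id g]
  congr 1
  ext y
  simp

theorem iterComm_mem {D : Subgroup G} [D.Normal] (g : List G) {u : G} (hu : u ∈ D) :
    iterComm g u ∈ D := by
  induction g generalizing u with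
  | nil => exact hu
  | cons z g ih => exact ih (comm₂_mem_left z hu)

/-- The twisted tail: see `iterComm_mul`. -/
def twist : G → List G → List G
  | _, [] => []
  | u, z :: g => z :: (twist (comm₂ u z) g).map (cj u⁻¹)

/-- The conjugating element in `iterComm_mul`. -/
def twistElt : G → List G → G
  | _, [] => 1
  | u, z :: g => u * twistElt (comm₂ u z) g

/-- Iteration of `[a u, z] = [a, z]^u [u, z]`: the conjugations produced at each step are pulled out
of the commutator, at the price of conjugating the later entries. `twist` records those entries and
`twistElt` the accumulated conjugator. -/
theorem iterComm_mul (g : List G) (a u : G) :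
    iterComm g (a * u) = cj (twistElt u g) (iterComm (twist u g) a) * iterComm g u := by
  induction g generalizing a u with
  | nil => simp [twist, twistElt]
  | cons z g ih =>
    rw [iterComm_cons, comm₂_mul_left, ih, iterComm_cj, cj_cj]
    simp [twist, twistElt]

theorem map_twist {K : Type*} [Group K] (f : G →* K) (u : G) (g : List G) :
    (twist u g).map f = twist (f u) (g.map f) := by
  induction g generalizing u with
  | nil => rfl
  | cons z g ih =>
    simp only [twist, List.map_cons, List.map_map, ← map_comm₂, ← ih]
    congr 2
    funext y
    simp [map_cj]

theorem map_twistElt {K : Type*} [Group K] (f : G →* K) (u : G) (g : List G) :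
    f (twistElt u g) = twistElt (f u) (g.map f) := by
  induction g generalizing u with
  | nil => simp [twistElt]
  | cons z g ih => simp [twistElt, ih, map_comm₂]

@[simp] theorem twist_one (g : List G) : twist (1 : G) g = g := by
  induction g with
  | nil => rfl
  | cons z g ih =>
    simp only [twist, comm₂_one_left, ih, inv_one]
    congr 1
    conv_rhs => rw [← List.map_id g]
    congr 1
    ext y
    simp

@[simp] theorem twistElt_one (g : List G) : twistElt (1 : G) g = 1 := by
  induction g with
  | nil => rfl
  | cons z g ih => simp [twistElt, ih]

@[simp] theorem length_twist (u : G) (g : List G) : (twist u g).length = g.length := by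
  induction g generalizing u with
  | nil => rfl
  | cons z g ih => simp [twist, ih]

theorem map_cj_inv_map_cj (u : G) (l : List G) : (l.map (cj u)).map (cj u⁻¹) = l := by
  rw [List.map_map]
  conv_rhs => rw [← List.map_id l]
  congr 1
  ext y
  simp

theorem twist_surjective (u : G) (k : List G) : ∃ g, twist u g = k := by
  induction hk : k.length generalizing u k with
  | zero => exact ⟨[], by rw [List.length_eq_zero_iff] at hk; simp [hk, twist]⟩
  | succ n ih =>
    obtain ⟨a, ks, rfl⟩ := List.exists_of_length_succ k hk
    obtain ⟨g, hg⟩ := ih (comm₂ u a) (ks.map (cj u)) (by simpa using hk)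
    exact ⟨a :: g, by rw [twist, hg, map_cj_inv_map_cj]⟩

theorem twist_injective (u : G) (g h : List G) (H : twist u g = twist u h) : g = h := by
  induction g generalizing u h with
  | nil =>
    have := congrArg List.length H
    simp only [length_twist, List.length_nil] at this
    exact (List.length_eq_zero_iff.mp this.symm).symm
  | cons z g ih =>
    cases h with
    | nil => simp [twist] at H
    | cons y h =>
      simp only [twist, List.cons.injEq] at H
      obtain ⟨rfl, H⟩ := H
      have inj : Function.Injective (cj u⁻¹) := (MulAut.conj u⁻¹⁻¹).injective
      rw [ih _ _ (List.map_injective_iff.mpr inj H)]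

/-- Two lists of elements that are entrywise congruent modulo a normal subgroup. -/
def CosetEq (D : Subgroup G) [D.Normal] (g h : List G) : Prop :=
  g.map (QuotientGroup.mk' D) = h.map (QuotientGroup.mk' D)

section CosetEq

variable {D : Subgroup G} [D.Normal]

theorem CosetEq.refl (g : List G) : CosetEq D g g := rfl

theorem CosetEq.trans {g h k : List G} (H : CosetEq D g h) (H' : CosetEq D h k) :
    CosetEq D g k := Eq.trans H H'

theorem CosetEq.length_eq {g h : List G} (H : CosetEq D g h) : g.length = h.length := by
  simpa using congrArg List.length H

theorem mk'_eq_one {c : G} (hc : c ∈ D) : QuotientGroup.mk' D c = 1 := by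
  simpa using hc

theorem cosetEq_cons {y z : G} {g h : List G} :
    CosetEq D (y :: g) (z :: h) ↔ (∃ c ∈ D, y = z * c) ∧ CosetEq D g h := by
  simp only [CosetEq, List.map_cons, List.cons.injEq]
  refine and_congr_left fun _ => ?_
  rw [eq_comm, QuotientGroup.mk'_eq_mk']
  exact exists_congr fun c => and_congr_right fun _ => eq_comm

theorem CosetEq.mono {D' : Subgroup G} [D'.Normal] (hD : D' ≤ D) {g h : List G}
    (H : CosetEq D' g h) : CosetEq D g h := by
  induction g generalizing h with
  | nil => cases h with
    | nil => rfl
    | cons => simpa using H.length_eq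
  | cons z g ih =>
    cases h with
    | nil => simpa using H.length_eq
    | cons y h =>
      rw [cosetEq_cons] at H ⊢
      obtain ⟨⟨c, hc, rfl⟩, H⟩ := H
      exact ⟨⟨c, hD hc, rfl⟩, ih H⟩

theorem CosetEq.map_cj {g h : List G} (H : CosetEq D g h) {d : G} (hd : d ∈ D) :
    CosetEq D (g.map (cj d)) h := by
  refine Eq.trans ?_ H
  rw [List.map_map]
  congr 1
  funext y
  simp only [Function.comp_apply, MaxOrderCommutators.map_cj, mk'_eq_one hd, cj_one_left]

theorem CosetEq.twist {u v : G} {g h : List G} (H : CosetEq D g h)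
    (huv : QuotientGroup.mk' D u = QuotientGroup.mk' D v) : CosetEq D (twist u g) (twist v h) := by
  unfold CosetEq at *
  rw [map_twist, map_twist, H, huv]

theorem CosetEq.twistElt {u v : G} {g h : List G} (H : CosetEq D g h)
    (huv : QuotientGroup.mk' D u = QuotientGroup.mk' D v) :
    QuotientGroup.mk' D (twistElt u g) = QuotientGroup.mk' D (twistElt v h) := by
  unfold CosetEq at *
  rw [map_twistElt, map_twistElt, H, huv]

/-- For fixed `u`, `twist u` is a bijection on lists, and it is compatible with reduction modulo
`D`. Thus ranging over all `k` in the cosets of `twist v h` is the same as ranging over all `g` in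
the cosets of `h`. -/
theorem CosetEq.exists_twist {u v : G} {k h : List G} (H : CosetEq D k (MaxOrderCommutators.twist v h))
    (huv : QuotientGroup.mk' D u = QuotientGroup.mk' D v) :
    ∃ g, CosetEq D g h ∧ MaxOrderCommutators.twist u g = k := by
  obtain ⟨g, rfl⟩ := twist_surjective u k
  refine ⟨g, ?_, rfl⟩
  unfold CosetEq at *
  rw [map_twist, map_twist, huv] at H
  exact twist_injective _ _ _ H

theorem cosetEq_twist_of_mem {b : G} (hb : b ∈ D) (g : List G) :
    CosetEq D (twist b g) g := by
  have := (CosetEq.refl (D := D) g).twist (u := b) (v := 1) (by rw [mk'_eq_one hb, map_one])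
  rwa [twist_one] at this

theorem twistElt_mem {b : G} (hb : b ∈ D) (g : List G) : twistElt b g ∈ D := by
  have := (CosetEq.refl (D := D) g).twistElt (u := b) (v := 1) (by rw [mk'_eq_one hb, map_one])
  rw [twistElt_one, map_one] at this
  simpa using this

end CosetEq

/-! ### Stable elements -/

theorem cj_eq_self_of_mem_centralizer {D : Subgroup G} {d y : G} (hd : d ∈ D)
    (hy : y ∈ Subgroup.centralizer (D : Set G)) : cj d y = y :=
  cj_eq_self_of_commute (Subgroup.mem_centralizer_iff.mp hy d hd)

/-- The elements `a` of `D` for which `[a, g₁, …, g_k]` does not depend on the choice of the `gᵢ`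
in the cosets `hᵢ D` and is centralised by `D`. -/
structure Stable (D : Subgroup G) [D.Normal] (h : List G) (a : G) : Prop where
  mem : a ∈ D
  eq : ∀ g, CosetEq D g h → iterComm g a = iterComm h a
  central : iterComm h a ∈ Subgroup.centralizer (D : Set G)

section Stable

variable {D : Subgroup G} [D.Normal] {h : List G} {a b : G}

theorem Stable.iterComm_mul_right (ha : Stable D h a) {g : List G} (hg : CosetEq D g h)
    (hb : b ∈ D) : iterComm g (a * b) = iterComm h a * iterComm g b := by
  rw [iterComm_mul, ha.eq _ ((cosetEq_twist_of_mem hb g).trans hg),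
    cj_eq_self_of_mem_centralizer (twistElt_mem hb g) ha.central]

theorem Stable.iterComm_mul (ha : Stable D h a) (hb : Stable D h b) :
    iterComm h (a * b) = iterComm h a * iterComm h b :=
  ha.iterComm_mul_right (CosetEq.refl h) hb.mem

theorem Stable.mul (ha : Stable D h a) (hb : Stable D h b) : Stable D h (a * b) where
  mem := D.mul_mem ha.mem hb.mem
  eq g hg := by rw [ha.iterComm_mul_right hg hb.mem, hb.eq g hg, ha.iterComm_mul hb]
  central := by rw [ha.iterComm_mul hb]; exact Subgroup.mul_mem _ ha.central hb.central

theorem Stable.iterComm_inv_of_cosetEq (ha : Stable D h a) {k : List G} (hk : CosetEq D k h) :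
    iterComm k a⁻¹ = (iterComm h a)⁻¹ := by
  have h1 : QuotientGroup.mk' D a = QuotientGroup.mk' D 1 := by rw [mk'_eq_one ha.mem, map_one]
  -- With `k = twist a g`, expanding `1 = [a⁻¹ a, g]` isolates `[a⁻¹, k]` up to conjugation by an
  -- element of `D`.
  obtain ⟨g, hg, rfl⟩ := CosetEq.exists_twist (u := a) (v := 1) (k := k) (h := h)
    (by rwa [twist_one]) h1
  have h2 := MaxOrderCommutators.iterComm_mul g a⁻¹ a
  rw [inv_mul_cancel, iterComm_one, ha.eq g hg] at h2
  have h3 : cj (twistElt a g) (iterComm (twist a g) a⁻¹) = (iterComm h a)⁻¹ :=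
    eq_inv_of_mul_eq_one_left h2.symm
  have h4 := congrArg (cj (twistElt a g)⁻¹) h3
  rwa [cj_inv_cj, cj_eq_self_of_mem_centralizer (D.inv_mem (twistElt_mem ha.mem g))
    (Subgroup.inv_mem _ ha.central)] at h4

theorem Stable.iterComm_inv (ha : Stable D h a) : iterComm h a⁻¹ = (iterComm h a)⁻¹ :=
  ha.iterComm_inv_of_cosetEq (CosetEq.refl h)

theorem Stable.inv (ha : Stable D h a) : Stable D h a⁻¹ where
  mem := D.inv_mem ha.mem
  eq g hg := by rw [ha.iterComm_inv_of_cosetEq hg, ha.iterComm_inv]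
  central := by rw [ha.iterComm_inv]; exact Subgroup.inv_mem _ ha.central

theorem Stable.iterComm_cj_of_cosetEq (ha : Stable D h a) {d : G} (hd : d ∈ D) {g : List G}
    (hg : CosetEq D g h) : iterComm g (cj d a) = iterComm h a := by
  rw [MaxOrderCommutators.iterComm_cj, ha.eq _ (hg.map_cj (D.inv_mem hd)),
    cj_eq_self_of_mem_centralizer hd ha.central]

theorem Stable.iterComm_cj (ha : Stable D h a) {d : G} (hd : d ∈ D) :
    iterComm h (cj d a) = iterComm h a := ha.iterComm_cj_of_cosetEq hd (CosetEq.refl h)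

theorem Stable.cj (ha : Stable D h a) {d : G} (hd : d ∈ D) :
    Stable D h (MaxOrderCommutators.cj d a) where
  mem := cj_mem d ha.mem
  eq g hg := by rw [ha.iterComm_cj_of_cosetEq hd hg, ha.iterComm_cj hd]
  central := by rw [ha.iterComm_cj hd]; exact ha.central

end Stable

end Conjugation

/-! ### Verbal subgroups, and making commutators constant on cosets -/

section Verbal

variable {G : Type*} [Group G]

/-- The subgroup of `D` generated by all commutators and all `e`-th powers of elements of `D`. -/
def verbal (e : ℕ) (D : Subgroup G) : Subgroup G :=
  ⁅D, D⁆ ⊔ Subgroup.closure ((fun c : G => c ^ e) '' (D : Set G))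

theorem closure_normal {S : Set G} (hS : ∀ d, ∀ s ∈ S, cj d s ∈ S) :
    (Subgroup.closure S).Normal := by
  refine ⟨fun n hn g => ?_⟩
  have h : (Subgroup.closure S).map (cj g⁻¹) ≤ Subgroup.closure S := by
    rw [MonoidHom.map_closure, Subgroup.closure_le]
    rintro _ ⟨s, hs, rfl⟩
    exact Subgroup.subset_closure (hS _ s hs)
  have := h (Subgroup.mem_map_of_mem _ hn)
  simpa [cj_apply] using this

instance verbal_normal (e : ℕ) (D : Subgroup G) [D.Normal] : (verbal e D).Normal := by
  have : (Subgroup.closure ((fun c : G => c ^ e) '' (D : Set G))).Normal := by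
    refine closure_normal ?_
    rintro d _ ⟨c, hc, rfl⟩
    exact ⟨cj d c, cj_mem d hc, by simp⟩
  unfold verbal
  infer_instance

theorem verbal_le (e : ℕ) (D : Subgroup G) : verbal e D ≤ D := by
  refine sup_le (Subgroup.commutator_le.mpr fun a ha b hb => ?_) ?_
  · rw [commutatorElement_def]
    exact D.mul_mem (D.mul_mem (D.mul_mem ha hb) (D.inv_mem ha)) (D.inv_mem hb)
  · rw [Subgroup.closure_le]
    rintro _ ⟨c, hc, rfl⟩
    exact D.pow_mem hc e

theorem verbal_le_ker {A : Type*} [Group A] (e : ℕ) (D : Subgroup G) (f : D →* A)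
    (hcomm : ∀ x y, f x * f y = f y * f x) (hpow : ∀ x, f x ^ e = 1) {c : G}
    (hc : c ∈ verbal e D) : f ⟨c, verbal_le e D hc⟩ = 1 := by
  have h : verbal e D ≤ f.ker.map D.subtype := by
    refine sup_le (Subgroup.commutator_le.mpr fun a ha b hb => ?_) ?_
    · refine ⟨⟨a, ha⟩ * ⟨b, hb⟩ * ⟨a, ha⟩⁻¹ * ⟨b, hb⟩⁻¹, ?_, by simp [commutatorElement_def]⟩
      rw [SetLike.mem_coe, MonoidHom.mem_ker, map_mul, map_mul, map_mul, hcomm ⟨a, ha⟩, map_inv,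
        map_inv]
      group
    · rw [Subgroup.closure_le]
      rintro _ ⟨a, ha, rfl⟩
      exact ⟨⟨a, ha⟩ ^ e, by rw [SetLike.mem_coe, MonoidHom.mem_ker, map_pow, hpow], by simp⟩
  obtain ⟨x, hx, hxc⟩ := h hc
  have : x = ⟨c, verbal_le e D hc⟩ := Subtype.ext hxc
  rw [← this]
  exact hx

/-- Iterates of `verbal e`. -/
def verbalIter (e : ℕ) : ℕ → Subgroup G → Subgroup G
  | 0, D => D
  | k + 1, D => verbal e (verbalIter e k D)

instance verbalIter_normal (e k : ℕ) (D : Subgroup G) [D.Normal] : (verbalIter e k D).Normal := by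
  induction k with
  | zero => assumption
  | succ k ih => exact verbal_normal e _

theorem verbalIter_le (e k : ℕ) (D : Subgroup G) : verbalIter e k D ≤ D := by
  induction k with
  | zero => exact le_rfl
  | succ k ih => exact (verbal_le e _).trans ih

theorem verbalIter_add (e j k : ℕ) (D : Subgroup G) :
    verbalIter e (j + k) D = verbalIter e k (verbalIter e j D) := by
  induction k with
  | zero => rfl
  | succ k ih => rw [← add_assoc, verbalIter, ih, verbalIter]

theorem pow_factorial_eq_one {T : Set G} (hT : T.Finite) {N : ℕ} (hN : T.ncard ≤ N) {y : G}
    (hy : ∀ i : ℕ, y ^ i ∈ T) : y ^ N.factorial = 1 := by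
  have hsub : ((Submonoid.powers y : Submonoid G) : Set G) ⊆ T := by
    rintro _ ⟨i, rfl⟩
    exact hy i
  have hfin : Finite (Submonoid.powers y) := (hT.subset hsub).to_subtype
  have hcard : orderOf y ≤ N := by
    rw [← Nat.card_submonoidPowers]
    exact (Set.ncard_le_ncard hsub hT).trans hN
  have hpos : 0 < orderOf y := by
    rw [← Nat.card_submonoidPowers]
    exact Nat.card_pos
  exact orderOf_dvd_iff_pow_eq_one.mp (Nat.dvd_factorial hpos hcard)

/-- A crossed map: `α (c c') = α(c') α(c)^{c'}`; for instance `c ↦ [w, c]` and `c ↦ c`. -/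
structure IsCrossed (α : G → G) : Prop where
  mul : ∀ c c', α (c * c') = α c' * cj c' (α c)
  mem : ∀ D : Subgroup G, D.Normal → ∀ c ∈ D, α c ∈ D

theorem IsCrossed.map_one {α : G → G} (h : IsCrossed α) : α 1 = 1 := by
  have := h.mul 1 1
  simpa using this

theorem IsCrossed.map_inv {α : G → G} (h : IsCrossed α) (c : G) :
    α c⁻¹ = cj c⁻¹ (α c)⁻¹ := by
  have := h.mul c c⁻¹
  rw [mul_inv_cancel, h.map_one] at this
  rw [_root_.map_inv]
  exact eq_inv_of_mul_eq_one_left this.symm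

theorem isCrossed_comm₂ (w : G) : IsCrossed (comm₂ w) where
  mul := comm₂_mul_right w
  mem _ _ _ hc := comm₂_mem_right w hc

theorem isCrossed_id : IsCrossed (fun c : G => c) where
  mul c c' := by simp [cj_apply, mul_assoc]
  mem _ _ _ hc := hc

/-- Stability absorbs the conjugation in the crossed identity, so `c ↦ [α(c), h]` is a homomorphism
on `D` with commuting values. All powers of a value lie in `T`, so its order is at most `N` and the
homomorphism kills `verbal N! D`. -/
theorem iterComm_crossed_eq_one {α : G → G}
    (hα : ∀ c c', α (c * c') = α c' * cj c' (α c)) {D : Subgroup G} [D.Normal] {h : List G}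
    (hst : ∀ c ∈ D, Stable D h (α c)) {T : Set G} (hT : T.Finite) {N : ℕ} (hN : T.ncard ≤ N)
    (hval : ∀ c ∈ D, iterComm h (α c) ∈ T) {c : G} (hc : c ∈ verbal N.factorial D) :
    iterComm h (α c) = 1 := by
  have hmul : ∀ c ∈ D, ∀ c' ∈ D,
      iterComm h (α (c * c')) = iterComm h (α c) * iterComm h (α c') := by
    intro c hc c' hc'
    rw [hα, (hst c' hc').iterComm_mul ((hst c hc).cj hc'), (hst c hc).iterComm_cj hc']
    exact (Subgroup.mem_centralizer_iff.mp (hst c hc).central _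
      (iterComm_mem h (hst c' hc').mem))
  let f : D →* G := MonoidHom.mk' (fun c => iterComm h (α c))
    fun a b => hmul a a.2 b b.2
  refine verbal_le_ker N.factorial D f (fun x y => ?_) (fun x => ?_) hc
  · exact (Subgroup.mem_centralizer_iff.mp (hst y y.2).central _
      (iterComm_mem h (hst x x.2).mem))
  · refine pow_factorial_eq_one hT hN fun i => ?_
    rw [← map_pow]
    exact hval _ (x ^ i).2

/-- Induction on the tail, one verbal step per entry. Once the remaining tail is stable, `c ↦ [y, c,
h]` is a homomorphism with at most `N` values. It vanishes on the next verbal subgroup, so replacing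
`z` by `z c` there changes nothing. -/
theorem stable_of_few (N : ℕ) {S : Set G} (hS : S.Finite) (hN : S.ncard ≤ N) (h : List G) :
    ∀ (Y : Set G) (D : Subgroup G) [D.Normal], S ⊆ Subgroup.centralizer (D : Set G) →
      Y ⊆ D → (∀ y ∈ Y, ∀ g, CosetEq D g h → iterComm g y ∈ S) →
      ∀ y ∈ Y, y ∈ verbalIter N.factorial h.length D →
        Stable (verbalIter N.factorial h.length D) h y := by
  induction h with
  | nil =>
    intro Y D _ hSD _ hval y hy hyD
    refine ⟨hyD, fun g hg => ?_, hSD (hval y hy [] (CosetEq.refl _))⟩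
    rw [List.length_eq_zero_iff.mp hg.length_eq]
  | cons z h ih =>
    intro Y D _ hSD hYD hval y hy hyD
    set D' := verbalIter N.factorial h.length D with hD'
    have hD'D : D' ≤ D := verbalIter_le _ _ _
    have hcent : (Subgroup.centralizer (D : Set G) : Set G) ⊆ Subgroup.centralizer (D' : Set G) :=
      Subgroup.centralizer_le hD'D
    change y ∈ verbal N.factorial D' at hyD
    have hyD' : y ∈ D' := verbal_le _ _ hyD
    have hst : ∀ c ∈ D', Stable D' h (comm₂ y (z * c)) := by
      intro c hc
      -- The hypothesis on values is available for all `c ∈ D`, and a single verbal subgroup serves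
      -- all the shifted elements `[y, z c]`.
      refine ih {u | ∃ y ∈ Y, ∃ c ∈ D, u = comm₂ y (z * c)} D hSD ?_ ?_ _
        ⟨y, hy, c, hD'D hc, rfl⟩ (comm₂_mem_left _ hyD')
      · rintro _ ⟨y, hy, c, hc, rfl⟩
        exact comm₂_mem_left _ (hYD hy)
      · rintro _ ⟨y, hy, c, hc, rfl⟩ g hg
        exact hval y hy ((z * c) :: g) (cosetEq_cons.mpr ⟨⟨c, hc, rfl⟩, hg⟩)
    have hst0 : Stable D' h (comm₂ y z) := by simpa using hst 1 D'.one_mem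
    have hEq : ∀ c, comm₂ y c = comm₂ y (z * c) * (cj c (comm₂ y z))⁻¹ := by
      intro c
      rw [comm₂_mul_right, mul_inv_cancel_right]
    have hst' : ∀ c ∈ D', Stable D' h (comm₂ y c) := by
      intro c hc
      rw [hEq]
      exact (hst c hc).mul (hst0.cj hc).inv
    have hone : ∀ c ∈ verbal N.factorial D', iterComm h (comm₂ y c) = 1 := by
      intro c hc
      refine iterComm_crossed_eq_one (comm₂_mul_right y) hst'
        (hS.image (fun s => s * (iterComm h (comm₂ y z))⁻¹))
        ((Set.ncard_image_le hS).trans hN) ?_ hc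
      intro c hc
      refine ⟨iterComm h (comm₂ y (z * c)), ?_, ?_⟩
      · exact hval y hy ((z * c) :: h) (cosetEq_cons.mpr ⟨⟨c, hD'D hc, rfl⟩, CosetEq.refl h⟩)
      · dsimp only
        rw [hEq c, (hst c hc).iterComm_mul (hst0.cj hc).inv, (hst0.cj hc).iterComm_inv,
          hst0.iterComm_cj hc]
    refine ⟨hyD, ?_, ?_⟩
    · intro g hg
      change CosetEq (verbal N.factorial D') g (z :: h) at hg
      cases g with
      | nil => simpa using hg.length_eq
      | cons x g =>
        rw [cosetEq_cons] at hg
        obtain ⟨⟨c, hc, rfl⟩, hg⟩ := hg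
        have hcD' := verbal_le _ _ hc
        rw [iterComm_cons, (hst c hcD').eq g (hg.mono (verbal_le _ _)), comm₂_mul_right,
          (hst' c hcD').iterComm_mul (hst0.cj hcD'), hone c hc, one_mul, hst0.iterComm_cj hcD']
        rfl
    · exact hcent (hSD (hval y hy (z :: h) (CosetEq.refl _))) |>
        fun H => Subgroup.centralizer_le (verbal_le N.factorial D') H

theorem cosetEq_iterComm_cj {D : Subgroup G} [D.Normal] {v x : G} {h : List G}
    (hx : x ∈ Subgroup.centralizer (D : Set G))
    (hI : ∀ g, CosetEq D g h → iterComm g v = x) {c : G} (hc : c ∈ D) {g : List G}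
    (hg : CosetEq D g h) : iterComm g (cj c v) = x := by
  rw [iterComm_cj, hI _ (hg.map_cj (D.inv_mem hc)), cj_eq_self_of_mem_centralizer hc hx]

theorem mk'_cj {D : Subgroup G} [D.Normal] {c : G} (hc : c ∈ D) (v : G) :
    QuotientGroup.mk' D (cj c v) = QuotientGroup.mk' D v := by
  rw [map_cj, mk'_eq_one hc, cj_one_left]

/-- If `[α(c) v^c, g₁, …, g_k] x⁻¹` takes few values, all centralised by `D`, for `c ∈ D` and
`gᵢ ∈ hᵢ D`, then on a verbal subgroup it is trivial. -/
theorem coset_step (N : ℕ) {S : Set G} (hS : S.Finite) (hN : S.ncard ≤ N)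
    {D : Subgroup G} [D.Normal] (hSD : S ⊆ Subgroup.centralizer (D : Set G))
    {α : G → G} (hα : IsCrossed α) {v x : G} {h : List G}
    (hx : x ∈ Subgroup.centralizer (D : Set G))
    (hI : ∀ g, CosetEq D g h → iterComm g v = x)
    (ht : ∀ c ∈ D, ∀ g, CosetEq D g h → iterComm g (α c * cj c v) * x⁻¹ ∈ S) :
    (∀ c ∈ verbalIter N.factorial (h.length + 1) D, ∀ g,
      CosetEq (verbalIter N.factorial (h.length + 1) D) g h →
        iterComm g (α c * cj c v) = x) ∧
    (∀ c ∈ verbalIter N.factorial (h.length + 1) D, ∀ k,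
      CosetEq (verbalIter N.factorial (h.length + 1) D) k (twist v h) →
        iterComm k (α c) = 1) := by
  have hval : ∀ c ∈ D, ∀ k, CosetEq D k (twist v h) →
      iterComm k (α c) ∈ cj (twistElt v h)⁻¹ '' S := by
    intro c hc k hk
    obtain ⟨g, hg, rfl⟩ := hk.exists_twist (u := cj c v) (mk'_cj hc v)
    have h1 := iterComm_mul g (α c) (cj c v)
    rw [cosetEq_iterComm_cj hx hI hc hg] at h1
    have h2 := ht c hc g hg
    rw [h1, mul_inv_cancel_right] at h2
    -- Modulo `D` the conjugator does not depend on `c` or `g`, and `D` centralises `S`. Hence the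
    -- values `[α(c), k]` all lie in one fixed conjugate of `S`.
    have h3 := hg.twistElt (mk'_cj hc v)
    rw [eq_comm, QuotientGroup.mk'_eq_mk'] at h3
    obtain ⟨d, hd, h3⟩ := h3
    refine ⟨_, h2, ?_⟩
    have h4 : (twistElt v h)⁻¹ = d * (twistElt (cj c v) g)⁻¹ := by rw [← h3]; group
    rw [h4, ← cj_cj d, cj_eq_self_of_mem_centralizer hd (hSD h2), cj_inv_cj]
  set e := twistElt v h with he
  have hS' : (cj e⁻¹ '' S).Finite := hS.image _
  have hN' : (cj e⁻¹ '' S).ncard ≤ N := (Set.ncard_image_le hS).trans hN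
  have hSD' : cj e⁻¹ '' S ⊆ Subgroup.centralizer (D : Set G) := by
    rintro _ ⟨s, hs, rfl⟩
    rw [SetLike.mem_coe, Subgroup.mem_centralizer_iff]
    intro d hd
    have h1 := Subgroup.mem_centralizer_iff.mp (hSD hs) (cj e d) (cj_mem e hd)
    have h2 := congrArg (cj e⁻¹) h1
    simpa using h2
  have hlen : (twist v h).length = h.length := length_twist v h
  have hst := stable_of_few N hS' hN' (twist v h) (α '' D) D hSD'
    (by rintro _ ⟨c, hc, rfl⟩; exact hα.mem D inferInstance c hc)
    (by rintro _ ⟨c, hc, rfl⟩ g hg; exact hval c hc g hg)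
  set D' := verbalIter N.factorial (twist v h).length D with hD'
  have hD'D : D' ≤ D := verbalIter_le _ _ _
  have hst' : ∀ c ∈ D', Stable D' (twist v h) (α c) := fun c hc =>
    hst _ ⟨c, hD'D hc, rfl⟩ (hα.mem D' inferInstance c hc)
  have hD'' : verbalIter N.factorial (h.length + 1) D = verbal N.factorial D' := by
    rw [hD', length_twist]
    rfl
  have key : ∀ c ∈ verbalIter N.factorial (h.length + 1) D, ∀ k,
      CosetEq (verbalIter N.factorial (h.length + 1) D) k (twist v h) →
        iterComm k (α c) = 1 := by
    intro c hc k hk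
    have hc' : c ∈ verbal N.factorial D' := hD'' ▸ hc
    rw [(hst' c (verbal_le _ _ hc')).eq k (hk.mono (hD''.le.trans (verbal_le _ _)))]
    exact iterComm_crossed_eq_one hα.mul hst' hS' hN'
      (fun c hc => hval c (hD'D hc) _ (CosetEq.refl _)) hc'
  refine ⟨fun c hc g hg => ?_, key⟩
  have hcD : c ∈ D := verbalIter_le _ _ _ hc
  rw [iterComm_mul, key c hc _ (hg.twist (mk'_cj hc v)), _root_.map_one, one_mul]
  exact cosetEq_iterComm_cj hx hI hcD (hg.mono (verbalIter_le _ _ _))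

/-- The number of verbal steps needed to treat a tail of length `k`. -/
def chainLength : ℕ → ℕ
  | 0 => 0
  | k + 1 => chainLength k + (k + 1)

/-- The condition on `D` and `S` needed to apply `coset_step` along a commutator `x`
of length `ℓ`. -/
def FewCosetValues (ℓ : ℕ) (D₀ : Subgroup G) (S : Set G) (x : G) : Prop :=
  ∀ D : Subgroup G, ∀ _ : D.Normal, D ≤ D₀ → ∀ α : G → G, IsCrossed α → ∀ (v : G) (h : List G),
    (∀ c, ∀ g : List G, g.length = h.length → iterComm g (α c) ∈ commutatorsOfLength G ℓ) →
    (∀ c, ∀ g : List G, g.length = h.length →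
      iterComm g (α c * cj c v) ∈ commutatorsOfLength G ℓ) →
    (∀ g, CosetEq D g h → iterComm g v = x) →
    ∀ c ∈ D, ∀ g, CosetEq D g h → iterComm g (α c * cj c v) * x⁻¹ ∈ S

theorem iterComm_mem_commutatorsOfLength (g : List G) (u : G) :
    iterComm g u ∈ commutatorsOfLength G (g.length + 1) := ⟨u :: g, by simp, rfl⟩

/-- The entries are freed from the last to the first. With `w` the commutator of the entries before
`z`, `coset_step` is applied to `α = [w, ·]` and `v = [w, z]`, because `[w, z c] = [w, c] [w, z]^c`.
A tail of length `k` costs `k + 1` verbal steps. The first entry is handled by `α = id`, since `x₁ c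
= c x₁^c`. -/
theorem coset_chain (N : ℕ) {S : Set G} (hS : S.Finite) (hN : S.ncard ≤ N)
    {D₀ : Subgroup G} [D₀.Normal] (hSD : S ⊆ Subgroup.centralizer (D₀ : Set G))
    (x₁ : G) (rest : List G)
    (hx : iterComm rest x₁ ∈ Subgroup.centralizer (D₀ : Set G))
    (hfew : FewCosetValues (rest.length + 1) D₀ S (iterComm rest x₁)) :
    (∀ c ∈ verbalIter N.factorial (chainLength (rest.length + 1)) D₀, ∀ g,
      CosetEq (verbalIter N.factorial (chainLength (rest.length + 1)) D₀) g rest →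
        iterComm g (x₁ * c) = iterComm rest x₁) ∧
    (∀ c ∈ verbalIter N.factorial (chainLength (rest.length + 1)) D₀, ∀ g,
      CosetEq (verbalIter N.factorial (chainLength (rest.length + 1)) D₀) g (twist x₁ rest) →
        iterComm g c = 1) := by
  have main : ∀ h pre : List G, pre ++ h = rest → ∀ g,
      CosetEq (verbalIter N.factorial (chainLength h.length) D₀) g h →
        iterComm g (iterComm pre x₁) = iterComm rest x₁ := by
    intro h
    induction h with
    | nil =>
      intro pre hpre g hg
      rw [List.length_eq_zero_iff.mp hg.length_eq, ← hpre, List.append_nil, iterComm_nil]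
    | cons z h ih =>
      intro pre hpre
      have hI := ih (pre ++ [z]) (by simpa using hpre)
      have hlen : pre.length + 1 + h.length = rest.length := by
        rw [← hpre]; simp; omega
      set D := verbalIter N.factorial (chainLength h.length) D₀ with hD
      have hDD : D ≤ D₀ := verbalIter_le _ _ _
      have hcent := Subgroup.centralizer_le (show (D : Set G) ⊆ D₀ from hDD)
      set w := iterComm pre x₁ with hw
      have hcj : ∀ c, comm₂ w c * cj c (comm₂ w z) = comm₂ w (z * c) :=
        fun c => (comm₂_mul_right w z c).symm
      have hv : iterComm (pre ++ [z]) x₁ = comm₂ w z := by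
        rw [iterComm_append]; rfl
      rw [hv] at hI
      have hL : ∀ c, ∀ g : List G, g.length = h.length →
          iterComm g (comm₂ w c) ∈ commutatorsOfLength G (rest.length + 1) := by
        intro c g hg
        have : iterComm g (comm₂ w c) = iterComm (pre ++ c :: g) x₁ := by
          rw [iterComm_append]; rfl
        rw [this, show rest.length + 1 = (pre ++ c :: g).length + 1 by simp; omega]
        exact iterComm_mem_commutatorsOfLength _ _
      have hstep := (coset_step N hS hN (hSD.trans hcent) (isCrossed_comm₂ w) (hcent hx) hI
        (hfew D inferInstance hDD _ (isCrossed_comm₂ w) _ h hL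
          (fun c g hg => by rw [hcj]; exact hL _ g hg) hI)).1
      have hadd : verbalIter N.factorial (chainLength (z :: h).length) D₀ =
          verbalIter N.factorial (h.length + 1) D := verbalIter_add _ _ _ _
      intro g hg
      replace hg := hg.mono hadd.le
      cases g with
      | nil => simpa using hg.length_eq
      | cons y g =>
        obtain ⟨⟨c, hc, rfl⟩, hg'⟩ := cosetEq_cons.mp hg
        rw [iterComm_cons, ← hcj]
        exact hstep c hc g hg'
  have hI := main rest [] rfl
  rw [iterComm_nil] at hI
  set D := verbalIter N.factorial (chainLength rest.length) D₀ with hD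
  have hDD : D ≤ D₀ := verbalIter_le _ _ _
  have hcent := Subgroup.centralizer_le (show (D : Set G) ⊆ D₀ from hDD)
  have hL : ∀ u, ∀ g : List G, g.length = rest.length →
      iterComm g u ∈ commutatorsOfLength G (rest.length + 1) := by
    intro u g hg
    rw [← hg]
    exact iterComm_mem_commutatorsOfLength _ _
  have hstep := coset_step N hS hN (hSD.trans hcent) isCrossed_id (hcent hx) hI
    (hfew D inferInstance hDD _ isCrossed_id _ rest (fun c g hg => hL _ g hg)
      (fun c g hg => hL _ g hg) hI)
  have hadd : verbalIter N.factorial (chainLength (rest.length + 1)) D₀ =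
      verbalIter N.factorial (rest.length + 1) D := verbalIter_add _ _ _ _
  refine ⟨fun c hc g hg => ?_, fun c hc g hg =>
    hstep.2 c (hadd ▸ hc) g (hg.mono hadd.le)⟩
  have := hstep.1 c (hadd ▸ hc) g (hg.mono hadd.le)
  rwa [show c * cj c x₁ = x₁ * c by simp [cj_apply, mul_assoc]] at this

end Verbal

/-! ### Index bounds, the order alternative and a nilpotent subgroup of bounded index -/

section Bounds

variable {G : Type*} [Group G]

theorem CosetEq.append_singleton {D : Subgroup G} [D.Normal] {k h : List G} (H : CosetEq D k h)
    (z : G) {d : G} (hd : d ∈ D) : CosetEq D (k ++ [z * d]) (h ++ [z]) := by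
  unfold CosetEq at *
  rw [List.map_append, List.map_append, H, List.map_singleton, List.map_singleton, map_mul,
    mk'_eq_one hd, mul_one]

/-- The last entry is removed at the cost of one step up the upper central series: if `[u, z d] ∈
Z_i(D)` for every `d ∈ D`, then `[u, d] = [u, z d] ([u, z]⁻¹)^d` lies in `Z_i(D)`, so `u ∈
Z_{i+1}(D)`. -/
theorem mem_upperCentralSeries_of_iterComm {D : Subgroup G} [D.Normal] (h : List G) :
    ∀ i, (∀ c ∈ D, ∀ k, CosetEq D k h →
      iterComm k c ∈ (Subgroup.upperCentralSeries D i).map D.subtype) →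
      ∀ c ∈ D, c ∈ (Subgroup.upperCentralSeries D (i + h.length)).map D.subtype := by
  induction h using List.reverseRecOn with
  | nil => exact fun i hi c hc => hi c hc [] (CosetEq.refl _)
  | append_singleton h z ih =>
    intro i hi
    have := ih (i + 1) ?_
    · rwa [List.length_append, List.length_singleton, add_comm h.length, ← add_assoc]
    intro c hc k hk
    have hu : iterComm k c ∈ D := iterComm_mem k hc
    set u := iterComm k c with hu'
    have h1 : ∀ d ∈ D, comm₂ u (z * d) ∈ (Subgroup.upperCentralSeries D i).map D.subtype := by
      intro d hd
      have := hi c hc (k ++ [z * d]) (hk.append_singleton z hd)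
      rwa [iterComm_append] at this
    have h2 : ∀ d : D, (⟨u, hu⟩⁻¹ * d⁻¹ * ⟨u, hu⟩ * d : D) ∈ Subgroup.upperCentralSeries D i := by
      intro d
      obtain ⟨a, ha, hae⟩ := h1 d d.2
      obtain ⟨b, hb, hbe⟩ := h1 1 D.one_mem
      rw [mul_one] at hbe
      have hd : (⟨u, hu⟩⁻¹ * d⁻¹ * ⟨u, hu⟩ * d : D) = a * (d⁻¹ * b⁻¹ * d⁻¹⁻¹) := by
        apply Subtype.ext
        have h3 := comm₂_mul_right u z d
        rw [← hae, ← hbe, cj_apply] at h3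
        simp only [Subgroup.coe_subtype] at h3
        simp only [Subgroup.coe_mul, Subgroup.coe_inv, h3]
        simp [comm₂, mul_assoc]
      rw [hd]
      exact Subgroup.mul_mem _ ha (Subgroup.Normal.conj_mem inferInstance _
        (Subgroup.inv_mem _ hb) _)
    refine ⟨⟨u, hu⟩, ?_, rfl⟩
    rw [SetLike.mem_coe, ← Subgroup.inv_mem_iff, Subgroup.mem_upperCentralSeries_succ_iff]
    intro d
    have := h2 d⁻¹
    simpa [commutatorElement_def] using this

theorem lowerCentralSeries_eq_bot_of_iterComm {D : Subgroup G} [D.Normal] (h : List G)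
    (H : ∀ c ∈ D, ∀ k, CosetEq D k h → iterComm k c = 1) :
    D.lowerCentralSeries h.length = ⊥ := by
  have h1 := mem_upperCentralSeries_of_iterComm h 0
    (fun c hc k hk => by rw [H c hc k hk]; exact Subgroup.one_mem _)
  rw [zero_add] at h1
  have h2 : Subgroup.upperCentralSeries D h.length = ⊤ := by
    rw [eq_top_iff]
    intro c _
    obtain ⟨a, ha, hac⟩ := h1 c c.2
    rwa [← Subtype.ext hac]
  rw [← Subgroup.lowerCentralSeries_eq_bot_iff_upperCentralSeries_eq_top] at h2
  rw [← Subgroup.top_subtype_lowerCentralSeries, h2, Subgroup.map_bot]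

theorem IsGeneratedBy.fg {r : ℕ} (h : IsGeneratedBy G r) : Group.FG G := by
  obtain ⟨f, hf⟩ := h
  exact Group.fg_iff.mpr ⟨_, hf, Set.finite_range f⟩

theorem IsGeneratedBy.rank_le {r : ℕ} (h : IsGeneratedBy G r) [Group.FG G] : Group.rank G ≤ r := by
  classical
  obtain ⟨f, hf⟩ := h
  have h1 : Subgroup.closure ((Finset.univ.image f : Finset G) : Set G) = ⊤ := by simpa using hf
  exact (Group.rank_le h1).trans (Finset.card_image_le.trans (by simp))

theorem IsGeneratedBy.of_surjective {K : Type*} [Group K] {r : ℕ} (h : IsGeneratedBy G r)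
    (φ : G →* K) (hφ : Function.Surjective φ) : IsGeneratedBy K r := by
  obtain ⟨f, hf⟩ := h
  refine ⟨φ ∘ f, ?_⟩
  rw [Set.range_comp, ← MonoidHom.map_closure, hf, ← MonoidHom.range_eq_map,
    MonoidHom.range_eq_top.mpr hφ]

/-- The quotient is abelian, of exponent dividing `e`, and needs no more generators than `D`. -/
theorem relIndex_verbal_dvd (e : ℕ) (D : Subgroup G) [D.Normal] [Group.FG D] :
    (verbal e D).relIndex D ∣ e ^ Group.rank D := by
  set V := (verbal e D).subgroupOf D with hV
  have hmem : ∀ c : D, c ∈ V ↔ (c : G) ∈ verbal e D := fun c => Subgroup.mem_subgroupOf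
  let : CommGroup (D ⧸ V) :=
    { (inferInstance : Group (D ⧸ V)) with
      mul_comm := by
        intro a b
        obtain ⟨a, rfl⟩ := QuotientGroup.mk'_surjective V a
        obtain ⟨b, rfl⟩ := QuotientGroup.mk'_surjective V b
        rw [← map_mul, ← map_mul, QuotientGroup.mk'_eq_mk']
        refine ⟨b⁻¹ * a⁻¹ * b * a, ?_, by group⟩
        rw [hmem]
        refine Subgroup.mem_sup_left ?_
        have := Subgroup.commutator_mem_commutator (D.inv_mem b.2) (D.inv_mem a.2)
        simpa [commutatorElement_def] using this }
  have hpow : ∀ q : D ⧸ V, q ^ e = 1 := by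
    intro q
    obtain ⟨a, rfl⟩ := QuotientGroup.mk'_surjective V q
    rw [← map_pow, ← MonoidHom.mem_ker, QuotientGroup.ker_mk', hmem]
    exact Subgroup.mem_sup_right (Subgroup.subset_closure ⟨a, a.2, by simp⟩)
  have hrank : Group.rank (D ⧸ V) ≤ Group.rank D :=
    Group.rank_le_of_surjective (QuotientGroup.mk' V) (QuotientGroup.mk'_surjective V)
  exact (card_dvd_exponent_pow_rank' (D ⧸ V) hpow).trans (pow_dvd_pow _ hrank)

/-- Bounds for the index of the iterates of `verbal e`, starting at a subgroup of index `b`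
of a group generated by `r` elements. -/
def verbalIndexBound (r e b : ℕ) : ℕ → ℕ
  | 0 => b
  | k + 1 => verbalIndexBound r e b k * e ^ (verbalIndexBound r e b k * r)

theorem verbalIter_finiteIndex {r e b : ℕ} (he : 0 < e) (hG : IsGeneratedBy G r)
    (D : Subgroup G) [D.Normal] (hD : D.FiniteIndex) (hb : D.index ≤ b) (k : ℕ) :
    (verbalIter e k D).FiniteIndex ∧
      (verbalIter e k D).index ≤ verbalIndexBound r e b k := by
  have := hG.fg
  induction k with
  | zero => exact ⟨hD, hb⟩
  | succ k ih =>
    obtain ⟨h1, h2⟩ := ih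
    set K := verbalIter e k D with hK
    have hdvd := relIndex_verbal_dvd e K
    have hpos : 0 < e ^ Group.rank K := pow_pos he _
    have hle := Nat.le_of_dvd hpos hdvd
    have hne : (verbal e K).relIndex K ≠ 0 := fun h => by
      rw [h, zero_dvd_iff] at hdvd
      omega
    have hmul := Subgroup.relIndex_mul_index (verbal_le e K)
    have hrank : Group.rank K ≤ verbalIndexBound r e b k * r :=
      (Subgroup.rank_le_index_mul_rank K).trans (Nat.mul_le_mul h2 hG.rank_le)
    refine ⟨⟨?_⟩, ?_⟩
    · change (verbal e K).index ≠ 0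
      rw [← hmul]
      exact mul_ne_zero hne h1.index_ne_zero
    · change (verbal e K).index ≤ _
      rw [← hmul, mul_comm]
      exact Nat.mul_le_mul h2 (hle.trans (Nat.pow_le_pow_right he hrank))

theorem centralizer_normal {X : Set G} (hX : ∀ d, ∀ y ∈ X, cj d y ∈ X) :
    (Subgroup.centralizer X).Normal := by
  refine ⟨fun n hn g => ?_⟩
  rw [Subgroup.mem_centralizer_iff] at hn ⊢
  intro y hy
  have := hn _ (hX g y hy)
  rw [cj_apply] at this
  calc y * (g * n * g⁻¹) = g * (g⁻¹ * y * g * n) * g⁻¹ := by group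
    _ = g * n * g⁻¹ * y := by rw [this]; group

/-- Conjugation embeds the coset space into the self-maps of `X`. The base `m + 1` is used only to
keep it positive. -/
theorem centralizer_finiteIndex {X : Set G} (hX : ∀ d, ∀ y ∈ X, cj d y ∈ X) (hfin : X.Finite)
    {m : ℕ} (hm : X.ncard ≤ m) :
    (Subgroup.centralizer X).FiniteIndex ∧ (Subgroup.centralizer X).index ≤ (m + 1) ^ m := by
  have := hfin.to_subtype
  let f : G ⧸ Subgroup.centralizer X → X → X := fun q y => ⟨cj q.out⁻¹ y, hX _ _ y.2⟩
  have hf : Function.Injective f := by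
    intro q q' h
    rw [← q.out_eq', ← q'.out_eq']
    refine QuotientGroup.eq.mpr (Subgroup.mem_centralizer_iff.mpr fun y hy => ?_)
    have h1 := congrArg Subtype.val (congrFun h ⟨y, hy⟩)
    simp only [f, cj_apply, inv_inv] at h1
    calc y * (q.out⁻¹ * q'.out) = q.out⁻¹ * (q.out * y * q.out⁻¹) * q'.out := by group
      _ = _ := by rw [h1]; group
  have : Finite (G ⧸ Subgroup.centralizer X) := Finite.of_injective f hf
  refine ⟨Subgroup.finiteIndex_of_finite_quotient, ?_⟩
  have h1 := Nat.card_le_card_of_injective f hf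
  rw [Nat.card_fun, Nat.card_coe_set_eq] at h1
  exact h1.trans ((Nat.pow_le_pow_left (hm.trans (Nat.le_succ m)) _).trans
    (Nat.pow_le_pow_right (Nat.succ_pos m) hm))

theorem leftNormedComm_cons (x : G) (xs : List G) : leftNormedComm (x :: xs) = iterComm xs x := rfl

theorem mem_commutatorsOfLength_iff {ℓ : ℕ} (hℓ : 0 < ℓ) {y : G} :
    y ∈ commutatorsOfLength G ℓ ↔
      ∃ (u : G) (g : List G), g.length + 1 = ℓ ∧ iterComm g u = y := by
  constructor
  · rintro ⟨xs, hxs, rfl⟩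
    cases xs with
    | nil => simp at hxs; omega
    | cons u g => exact ⟨u, g, by simpa using hxs, rfl⟩
  · rintro ⟨u, g, rfl, rfl⟩
    exact iterComm_mem_commutatorsOfLength g u

theorem map_mem_commutatorsOfLength {K : Type*} [Group K] (f : G →* K) {ℓ : ℕ} {y : G}
    (hy : y ∈ commutatorsOfLength G ℓ) : f y ∈ commutatorsOfLength K ℓ := by
  obtain ⟨xs, rfl, rfl⟩ := hy
  refine ⟨xs.map f, by simp, ?_⟩
  cases xs with
  | nil => simp [leftNormedComm]
  | cons u g => rw [List.map_cons, leftNormedComm_cons, leftNormedComm_cons, map_iterComm]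

theorem exists_of_mem_commutatorsOfLength {K : Type*} [Group K] (f : G →* K)
    (hf : Function.Surjective f) {ℓ : ℕ} {y : K} (hy : y ∈ commutatorsOfLength K ℓ) :
    ∃ x ∈ commutatorsOfLength G ℓ, f x = y := by
  obtain ⟨ys, rfl, rfl⟩ := hy
  obtain ⟨xs, rfl⟩ := List.map_surjective_iff.mpr hf ys
  refine ⟨leftNormedComm xs, ⟨xs, by simp, rfl⟩, ?_⟩
  cases xs with
  | nil => simp [leftNormedComm]
  | cons u g => rw [List.map_cons, leftNormedComm_cons, leftNormedComm_cons, map_iterComm]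

theorem cj_mem_commutatorsOfOrder {ℓ n : ℕ} (d : G) {y : G} (hy : y ∈ commutatorsOfOrder G ℓ n) :
    cj d y ∈ commutatorsOfOrder G ℓ n :=
  ⟨map_mem_commutatorsOfLength _ hy.1, by rw [orderOf_cj, hy.2]⟩

/-- The inverse of `[a, g₁, …, g_k]` is, up to conjugation by an element of `D`, a commutator of
the same shape starting with any `D`-conjugate of `a⁻¹`. -/
theorem exists_iterComm_inv {D : Subgroup G} [D.Normal] (g : List G) :
    ∀ a ∈ D, ∀ d ∈ D, ∃ g', CosetEq D g' g ∧ ∃ d' ∈ D,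
      iterComm g' (cj d a⁻¹) = cj d' (iterComm g a)⁻¹ := by
  induction g with
  | nil => exact fun a _ d hd => ⟨[], CosetEq.refl _, d, hd, rfl⟩
  | cons z g ih =>
    intro a ha d hd
    have h1 : comm₂ (cj d a⁻¹) (cj d z) = cj (a⁻¹ * d) (comm₂ a z)⁻¹ := by
      simp [comm₂, cj_apply, mul_assoc]
    obtain ⟨g', hg', d', hd', h2⟩ := ih (comm₂ a z) (comm₂_mem_left z ha) (a⁻¹ * d)
      (D.mul_mem (D.inv_mem ha) hd)
    refine ⟨cj d z :: g', cosetEq_cons.mpr ⟨⟨z⁻¹ * cj d z, ?_, by group⟩, hg'⟩, d', hd', ?_⟩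
    · have := comm₂_mem_right z hd
      simpa [comm₂, cj_apply, mul_assoc] using this
    · rw [iterComm_cons, h1, h2, iterComm_cons]

variable (G) in
/-- If `x` has order `n`, commutes with `t`, and `t`, `t x`, `t⁻¹ x` have order at most `n`, then
one of the latter three has order `n`. -/
def OrderAlternative (n : ℕ) : Prop :=
  ∀ x t : G, Commute x t → orderOf x = n → (IsOfFinOrder t ∧ orderOf t ≤ n) →
    (IsOfFinOrder (t * x) ∧ orderOf (t * x) ≤ n) →
    (IsOfFinOrder (t⁻¹ * x) ∧ orderOf (t⁻¹ * x) ≤ n) →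
    orderOf t = n ∨ orderOf (t * x) = n ∨ orderOf (t⁻¹ * x) = n

theorem prime_pow_dvd_of_dvd_lcm {p a m n : ℕ} (hp : p.Prime) (h : p ^ a ∣ Nat.lcm m n) :
    p ^ a ∣ m ∨ p ^ a ∣ n := by
  rcases eq_or_ne m 0 with rfl | hm
  · exact Or.inl (dvd_zero _)
  rcases eq_or_ne n 0 with rfl | hn
  · exact Or.inr (dvd_zero _)
  rw [hp.pow_dvd_iff_le_factorization (Nat.lcm_ne_zero hm hn), Nat.factorization_lcm hm hn,
    Finsupp.sup_apply, le_sup_iff] at h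
  rwa [hp.pow_dvd_iff_le_factorization hm, hp.pow_dvd_iff_le_factorization hn]

/-- Since `x = t⁻¹ (t x)`, the order of `x` divides the least common multiple of the orders of `t`
and `t x`, and a prime power dividing an lcm divides one of its arguments. -/
theorem dvd_orderOf_mul {p a : ℕ} (hp : p.Prime) {x t : G} (hxt : Commute x t)
    (hx : p ^ a ∣ orderOf x) (ht : ¬ p ^ a ∣ orderOf t) : p ^ a ∣ orderOf (t * x) := by
  have h1 : orderOf x ∣ Nat.lcm (orderOf (t * x)) (orderOf t) := by
    have hc : Commute t⁻¹ (t * x) :=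
      ((Commute.refl t).mul_right hxt.symm).inv_left
    have := hc.orderOf_mul_dvd_lcm
    rwa [inv_mul_cancel_left, orderOf_inv, Nat.lcm_comm] at this
  exact (prime_pow_dvd_of_dvd_lcm hp (hx.trans h1)).resolve_right ht

theorem orderOf_eq_of_dvd {n : ℕ} {y : G} (hy : IsOfFinOrder y ∧ orderOf y ≤ n)
    (h : n ∣ orderOf y) : orderOf y = n :=
  le_antisymm hy.2 (Nat.le_of_dvd hy.1.orderOf_pos h)

theorem orderAlternative_prime_pow {p a : ℕ} (hp : p.Prime) : OrderAlternative G (p ^ a) := by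
  intro x t hxt hx ht htx _
  by_cases h : p ^ a ∣ orderOf t
  · exact Or.inl (orderOf_eq_of_dvd ht h)
  · exact Or.inr (Or.inl (orderOf_eq_of_dvd htx (dvd_orderOf_mul hp hxt (dvd_of_eq hx.symm) h)))

/-- `(t x)(t⁻¹ x) = x²`, and squaring does not affect the `q`-part of the order when `q` is odd. -/
theorem dvd_orderOf_mul_or {q b : ℕ} (hq : q.Prime) (hodd : Odd q) {x t : G}
    (hxt : Commute x t) (hx : q ^ b ∣ orderOf x) :
    q ^ b ∣ orderOf (t * x) ∨ q ^ b ∣ orderOf (t⁻¹ * x) := by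
  refine prime_pow_dvd_of_dvd_lcm hq (dvd_trans ?_ (Commute.orderOf_mul_dvd_lcm ?_))
  · have h1 : t * x * (t⁻¹ * x) = x ^ 2 := by
      rw [hxt.eq.symm, pow_two]
      group
    rw [h1]
    have h2 : orderOf x ∣ 2 * orderOf (x ^ 2) :=
      orderOf_dvd_of_pow_eq_one (by rw [pow_mul, pow_orderOf_eq_one])
    exact Nat.Coprime.dvd_of_dvd_mul_left
      (Nat.Coprime.pow_left _ (Nat.coprime_two_right.mpr hodd)) (hx.trans h2)
  · have h3 : Commute t x := hxt.symm
    exact ((Commute.refl t).inv_right.mul_right h3).mul_left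
      ((h3.symm.inv_right).mul_right (Commute.refl x))

/-- If `t` lacks one of the two full prime powers, then both `t x` and `t⁻¹ x` have it. The other
prime power then occurs in at least one of these two orders, because that prime is odd. -/
theorem orderAlternative_two_primes {p q a b : ℕ} (hp : p.Prime) (hq : q.Prime) (hpo : Odd p)
    (hqo : Odd q) (hpq : p ≠ q) : OrderAlternative G (p ^ a * q ^ b) := by
  intro x t hxt hx ht htx htx'
  have hcop : Nat.Coprime (p ^ a) (q ^ b) := Nat.coprime_pow_primes _ _ hp hq hpq
  have hxp : p ^ a ∣ orderOf x := hx ▸ dvd_mul_right _ _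
  have hxq : q ^ b ∣ orderOf x := hx ▸ dvd_mul_left _ _
  have hxt' : Commute x t⁻¹ := hxt.inv_right
  by_cases h1 : p ^ a ∣ orderOf t
  · by_cases h2 : q ^ b ∣ orderOf t
    · exact Or.inl (orderOf_eq_of_dvd ht (hcop.mul_dvd_of_dvd_of_dvd h1 h2))
    · have h3 := dvd_orderOf_mul hq hxt hxq h2
      have h4 := dvd_orderOf_mul hq hxt' hxq (by rwa [orderOf_inv])
      rcases dvd_orderOf_mul_or hp hpo hxt hxp with h | h
      · exact Or.inr (Or.inl (orderOf_eq_of_dvd htx (hcop.mul_dvd_of_dvd_of_dvd h h3)))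
      · exact Or.inr (Or.inr (orderOf_eq_of_dvd htx' (hcop.mul_dvd_of_dvd_of_dvd h h4)))
  · have h3 := dvd_orderOf_mul hp hxt hxp h1
    have h4 := dvd_orderOf_mul hp hxt' hxp (by rwa [orderOf_inv])
    rcases dvd_orderOf_mul_or hq hqo hxt hxq with h | h
    · exact Or.inr (Or.inl (orderOf_eq_of_dvd htx (hcop.mul_dvd_of_dvd_of_dvd h3 h)))
    · exact Or.inr (Or.inr (orderOf_eq_of_dvd htx' (hcop.mul_dvd_of_dvd_of_dvd h4 h)))

/-- The value is `t x` with `t ∈ D` commuting with `x`. The three pieces of the set correspond to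
`t`, `t x` or `t⁻¹ x` being the element of order `n`. -/
theorem fewCosetValues_of_orderAlternative {ℓ n : ℕ} (hmax : IsMaximalCommutatorOrder G ℓ n)
    (halt : OrderAlternative G n) {x : G} (hx : x ∈ commutatorsOfOrder G ℓ n) :
    FewCosetValues ℓ (Subgroup.centralizer (commutatorsOfOrder G ℓ n))
      (commutatorsOfOrder G ℓ n ∪ (fun y => y * x⁻¹) '' commutatorsOfOrder G ℓ n ∪
        (fun y => x * y⁻¹) '' commutatorsOfOrder G ℓ n) x := by
  intro D _ hD α hα v h hL1 hL2 hI c hc g hg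
  have hxD : x ∈ Subgroup.centralizer (D : Set G) := Subgroup.mem_centralizer_iff.mpr
    fun d hd => (Subgroup.mem_centralizer_iff.mp (hD hd) x hx).symm
  have hxc : ∀ d ∈ D, cj d x = x := fun d hd => cj_eq_self_of_mem_centralizer hd hxD
  set k := twist (cj c v) g with hk
  set e := twistElt (cj c v) g with he
  have hkh : CosetEq D k (twist v h) := hg.twist (mk'_cj hc v)
  have hval : iterComm g (α c * cj c v) = cj e (iterComm k (α c)) * x := by
    rw [iterComm_mul, cosetEq_iterComm_cj hxD hI hc hg]
  have haD : α c ∈ D := hα.mem D inferInstance c hc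
  set t := cj e (iterComm k (α c)) with ht
  have htD : t ∈ D := cj_mem e (iterComm_mem k haD)
  have htL : t ∈ commutatorsOfLength G ℓ :=
    map_mem_commutatorsOfLength _ (hL1 c k (by rw [hk, length_twist, hg.length_eq]))
  have htxL : t * x ∈ commutatorsOfLength G ℓ := hval ▸ hL2 c g hg.length_eq
  have htxL' : t⁻¹ * x ∈ commutatorsOfLength G ℓ := by
    -- Replacing `c` by `c⁻¹` turns `α(c)` into a conjugate of its inverse. With suitable entries in
    -- the same cosets this produces a `D`-conjugate of `t⁻¹ x`, as `D` centralises `x`.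
    obtain ⟨k', hk', d', hd', hkd⟩ := exists_iterComm_inv k (α c) haD c⁻¹ (D.inv_mem hc)
    rw [← hα.map_inv] at hkd
    obtain ⟨g', hg', rfl⟩ := (hk'.trans hkh).exists_twist (u := cj c⁻¹ v)
      (mk'_cj (D.inv_mem hc) v)
    have h1 := hL2 c⁻¹ g' hg'.length_eq
    rw [iterComm_mul, hkd, cosetEq_iterComm_cj hxD hI (D.inv_mem hc) hg', cj_cj] at h1
    have h2 := (hg'.twistElt (mk'_cj (D.inv_mem hc) v)).trans (hg.twistElt (mk'_cj hc v)).symm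
    rw [eq_comm, QuotientGroup.mk'_eq_mk'] at h2
    obtain ⟨d, hd, h2⟩ := h2
    rw [← he] at h2
    set δ := e⁻¹ * d' * e * d with hδ
    have hδD : δ ∈ D := by
      refine D.mul_mem ?_ hd
      have := cj_mem e hd'
      rwa [cj_apply] at this
    have h3 : cj (d' * twistElt (cj c⁻¹ v) g') (iterComm k (α c))⁻¹ * x = cj δ (t⁻¹ * x) := by
      rw [map_mul, hxc δ hδD, ht, ← map_inv, cj_cj, ← h2, hδ]
      congr 3
      group
    rw [h3] at h1
    have := map_mem_commutatorsOfLength (cj δ⁻¹) h1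
    rwa [cj_inv_cj] at this
  rw [hval, mul_inv_cancel_right]
  have hcomm : Commute x t := (Subgroup.mem_centralizer_iff.mp hxD t htD).symm
  rcases halt x t hcomm hx.2 (hmax.1 t htL) (hmax.1 _ htxL) (hmax.1 _ htxL') with h | h | h
  · exact Or.inl (Or.inl ⟨htL, h⟩)
  · exact Or.inl (Or.inr ⟨t * x, ⟨htxL, h⟩, by group⟩)
  · exact Or.inr ⟨t⁻¹ * x, ⟨htxL', h⟩, by group⟩

/-- Under the order alternative, there is a normal subgroup of bounded index whose lower central
series is trivial at `ℓ`. -/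
theorem exists_normal_gamma_eq_bot {ℓ m n r : ℕ} (hℓ : 0 < ℓ) (hG : IsGeneratedBy G r)
    (hmax : IsMaximalCommutatorOrder G ℓ n) (hfin : (commutatorsOfOrder G ℓ n).Finite)
    (hm : (commutatorsOfOrder G ℓ n).ncard ≤ m) (halt : OrderAlternative G n) :
    ∃ M : Subgroup G, M.Normal ∧ M.FiniteIndex ∧
      M.index ≤ verbalIndexBound r (3 * m).factorial ((m + 1) ^ m) (chainLength ℓ) ∧
      M.lowerCentralSeries (ℓ - 1) = ⊥ := by
  obtain ⟨x, hxL, hxn⟩ := hmax.2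
  have hx : x ∈ commutatorsOfOrder G ℓ n := ⟨hxL, hxn⟩
  obtain ⟨x₁, rest, rfl, rfl⟩ := (mem_commutatorsOfLength_iff hℓ).mp hxL
  set x := iterComm rest x₁ with hxdef
  set X := commutatorsOfOrder G (rest.length + 1) n with hX
  set S := X ∪ (fun y => y * x⁻¹) '' X ∪ (fun y => x * y⁻¹) '' X with hS
  have hXcj : ∀ d, ∀ y ∈ X, cj d y ∈ X := fun d y hy => cj_mem_commutatorsOfOrder d hy
  have := centralizer_normal hXcj
  have hXc : X ⊆ Subgroup.centralizer (Subgroup.centralizer X : Set G) := fun y hy =>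
    Subgroup.mem_centralizer_iff.mpr fun d hd =>
      (Subgroup.mem_centralizer_iff.mp hd y hy).symm
  have hSfin : S.Finite := (hfin.union (hfin.image _)).union (hfin.image _)
  have hScard : S.ncard ≤ 3 * m := by
    have h1 := Set.ncard_image_le (f := fun y => y * x⁻¹) hfin
    have h2 := Set.ncard_image_le (f := fun y => x * y⁻¹) hfin
    have h3 := Set.ncard_union_le X ((fun y => y * x⁻¹) '' X)
    have h4 := Set.ncard_union_le (X ∪ (fun y => y * x⁻¹) '' X) ((fun y => x * y⁻¹) '' X)
    rw [hS]
    omega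
  have hSc : S ⊆ Subgroup.centralizer (Subgroup.centralizer X : Set G) := by
    rintro y ((hy | ⟨y, hy, rfl⟩) | ⟨y, hy, rfl⟩)
    · exact hXc hy
    · exact Subgroup.mul_mem _ (hXc hy) (Subgroup.inv_mem _ (hXc hx))
    · exact Subgroup.mul_mem _ (hXc hx) (Subgroup.inv_mem _ (hXc hy))
  have hchain := (coset_chain (3 * m) hSfin hScard hSc x₁ rest (hXc hx)
    (fewCosetValues_of_orderAlternative hmax halt hx)).2
  obtain ⟨h1, h2⟩ := centralizer_finiteIndex hXcj hfin hm
  obtain ⟨h3, h4⟩ := verbalIter_finiteIndex (Nat.factorial_pos (3 * m)) hG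
    (Subgroup.centralizer X) h1 h2 (chainLength (rest.length + 1))
  refine ⟨_, inferInstance, h3, h4, ?_⟩
  have := lowerCentralSeries_eq_bot_of_iterComm (twist x₁ rest) hchain
  rwa [length_twist] at this

end Bounds

-- Central cyclic series of finitely generated nilpotent groups

universe u

/-- `G` has a central series with `N` cyclic factors. -/
def HasCentralCyclicSeries : ℕ → ∀ (G : Type u) [Group G], Prop
  | 0, G, _ => Subsingleton G
  | N + 1, G, _ => ∃ a ∈ Subgroup.center G, ∃ (K : Type u) (_ : Group K) (f : G →* K),
      Function.Surjective f ∧ f.ker = Subgroup.zpowers a ∧ HasCentralCyclicSeries N K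

theorem HasCentralCyclicSeries.of_mulEquiv {N : ℕ} {G K : Type u} [Group G] [Group K]
    (e : G ≃* K) (h : HasCentralCyclicSeries N K) : HasCentralCyclicSeries N G := by
  cases N with
  | zero =>
    have : Subsingleton K := h
    exact e.toEquiv.subsingleton
  | succ N =>
    obtain ⟨a, ha, L, _, f, hf, hker, hL⟩ := h
    refine ⟨e.symm a, ?_, L, _, f.comp e.toMonoidHom, hf.comp e.surjective, ?_, hL⟩
    · rw [Subgroup.mem_center_iff] at ha ⊢
      intro g
      apply e.injective
      simpa using ha (e g)
    · ext x
      rw [MonoidHom.mem_ker, MonoidHom.comp_apply, ← MonoidHom.mem_ker, hker,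
        Subgroup.mem_zpowers_iff, Subgroup.mem_zpowers_iff]
      refine exists_congr fun k => ?_
      rw [← map_zpow, MulEquiv.symm_apply_eq]
      rfl

/-- A central kernel generated by `n` elements is factored out one cyclic subgroup at a time. -/
theorem hasCentralCyclicSeries_of_closure {N : ℕ} (n : ℕ) : ∀ {G K : Type u} [Group G] [Group K]
    (f : G →* K), Function.Surjective f → ∀ l : List G, l.length = n →
    (∀ a ∈ l, a ∈ Subgroup.center G) → f.ker = Subgroup.closure {a | a ∈ l} →
    HasCentralCyclicSeries N K → HasCentralCyclicSeries (N + n) G := by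
  induction n with
  | zero =>
    intro G K _ _ f hf l hl _ hker hK
    rw [List.length_eq_zero_iff.mp hl] at hker
    have hinj : Function.Injective f := by
      rw [← MonoidHom.ker_eq_bot_iff, hker]
      simp
    exact hK.of_mulEquiv (MulEquiv.ofBijective f ⟨hinj, hf⟩)
  | succ n ih =>
    intro G K _ _ f hf l hl hc hker hK
    obtain ⟨a, l, rfl⟩ := List.exists_of_length_succ l hl
    have ha : a ∈ Subgroup.center G := hc a (by simp)
    have hnorm : (Subgroup.zpowers a).Normal := by
      refine ⟨fun y hy g => ?_⟩
      obtain ⟨k, rfl⟩ := Subgroup.mem_zpowers_iff.mp hy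
      have h1 := Subgroup.mem_center_iff.mp (Subgroup.zpow_mem _ ha k) g
      rw [h1, mul_inv_cancel_right]
      exact hy
    have hle : Subgroup.zpowers a ≤ f.ker := by
      rw [hker, Subgroup.zpowers_le]
      exact Subgroup.subset_closure (by simp)
    set q := QuotientGroup.mk' (Subgroup.zpowers a) with hq
    have hqs : Function.Surjective q := QuotientGroup.mk'_surjective _
    have hqc : ∀ y ∈ Subgroup.center G, q y ∈ Subgroup.center (G ⧸ Subgroup.zpowers a) := by
      intro y hy
      rw [Subgroup.mem_center_iff] at hy ⊢
      intro z
      obtain ⟨z, rfl⟩ := hqs z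
      rw [← map_mul, ← map_mul, hy]
    refine ⟨a, ha, G ⧸ Subgroup.zpowers a, inferInstance, q, hqs, QuotientGroup.ker_mk' _, ?_⟩
    refine ih (QuotientGroup.lift _ f hle) ?_ (l.map q) (by simpa using hl) ?_ ?_ hK
    · exact QuotientGroup.lift_surjective_of_surjective _ _ hf hle
    · intro b hb
      obtain ⟨y, hy, rfl⟩ := List.mem_map.mp hb
      exact hqc y (hc y (by simp [hy]))
    · have h1 : (QuotientGroup.lift _ f hle).ker = f.ker.map q := by
        ext z
        obtain ⟨z, rfl⟩ := hqs z
        constructor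
        · intro hz
          exact ⟨z, hz, rfl⟩
        · rintro ⟨w, hw, hwz⟩
          rw [← hwz]
          exact hw
      rw [h1, hker, MonoidHom.map_closure]
      apply le_antisymm
      · rw [Subgroup.closure_le]
        rintro _ ⟨y, hy, rfl⟩
        rcases List.mem_cons.mp hy with rfl | hy
        · have : q y = 1 := by
            rw [← MonoidHom.mem_ker, hq, QuotientGroup.ker_mk']
            exact Subgroup.mem_zpowers y
          rw [this]
          exact Subgroup.one_mem _
        · exact Subgroup.subset_closure (List.mem_map_of_mem hy)
      · refine Subgroup.closure_mono ?_
        intro b hb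
        obtain ⟨y, hy, rfl⟩ := List.mem_map.mp hb
        exact ⟨y, by simp [hy], rfl⟩

section Generators

variable {G : Type u} [Group G]

/-- Left-normed commutators in the entries of `l`. -/
def commList (l : List G) : ℕ → List G
  | 0 => l
  | i + 1 => (commList l i).flatMap fun t => l.map (comm₂ t)

theorem length_commList (l : List G) (i : ℕ) : (commList l i).length = l.length ^ (i + 1) := by
  induction i with
  | zero => simp [commList]
  | succ i ih =>
    rw [commList, List.length_flatMap]
    simp [ih, pow_succ]

theorem commList_mem (l : List G) (i : ℕ) :
    ∀ t ∈ commList l i, t ∈ (⊤ : Subgroup G).lowerCentralSeries i := by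
  induction i with
  | zero => simp
  | succ i ih =>
    intro t ht
    simp only [commList, List.mem_flatMap, List.mem_map] at ht
    obtain ⟨s, hs, g, _, rfl⟩ := ht
    have := Subgroup.commutator_mem_commutator (Subgroup.inv_mem _ (ih s hs))
      (Subgroup.mem_top g⁻¹)
    simpa [commutatorElement_def, comm₂] using this

/-- In the quotient by the right-hand side at level `i + 1`, the generators of the previous term
commute with the generators of `G` and so are central. This makes the commutator of that term with
`G` trivial there. -/
theorem lowerCentralSeries_eq_closure_sup (l : List G) (hl : Subgroup.closure {a | a ∈ l} = ⊤)
    (i : ℕ) : (⊤ : Subgroup G).lowerCentralSeries i =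
      Subgroup.closure {a | a ∈ commList l i} ⊔ (⊤ : Subgroup G).lowerCentralSeries (i + 1) := by
  induction i with
  | zero => rw [commList, hl, top_sup_eq]; rfl
  | succ i ih =>
    set Γ := (⊤ : Subgroup G).lowerCentralSeries with hΓ
    set B := Subgroup.closure {a | a ∈ commList l (i + 1)} ⊔ Γ (i + 1 + 1) with hB
    have hBle : B ≤ Γ (i + 1) := by
      refine sup_le ((Subgroup.closure_le _).mpr (commList_mem l (i + 1))) ?_
      exact Subgroup.lowerCentralSeries_antitone _ (Nat.le_succ _)
    have hcomm : ∀ b ∈ Γ (i + 1), ∀ g : G, g * b * g⁻¹ * b⁻¹ ∈ B := by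
      intro b hb g
      refine Subgroup.mem_sup_right ?_
      have : (b * g * b⁻¹ * g⁻¹)⁻¹ ∈ Γ (i + 1 + 1) :=
        Subgroup.inv_mem _ (Subgroup.commutator_mem_commutator hb (Subgroup.mem_top g))
      simpa only [mul_inv_rev, inv_inv, mul_assoc] using this
    have hnorm : B.Normal := by
      refine ⟨fun b hb g => ?_⟩
      have := B.mul_mem (hcomm b (hBle hb) g) hb
      rwa [inv_mul_cancel_right] at this
    refine le_antisymm ?_ hBle
    set q := QuotientGroup.mk' B with hq
    have hqs : Function.Surjective q := QuotientGroup.mk'_surjective _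
    have hone : ∀ y, q y = 1 ↔ y ∈ B := fun y => by
      rw [← MonoidHom.mem_ker, hq, QuotientGroup.ker_mk']
    have hcent : ∀ y ∈ Γ i, q y ∈ Subgroup.center (G ⧸ B) := by
      have h1 : Γ i ≤ (Subgroup.center (G ⧸ B)).comap q := by
        rw [ih]
        refine sup_le ?_ ?_
        · rw [Subgroup.closure_le]
          intro t ht
          have h2 : (⊤ : Subgroup G) ≤ (Subgroup.centralizer {q t}).comap q := by
            rw [← hl, Subgroup.closure_le]
            intro s hs
            rw [SetLike.mem_coe, Subgroup.mem_comap, Subgroup.mem_centralizer_singleton_iff]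
            have h3 : comm₂ t s ∈ B := Subgroup.mem_sup_left (Subgroup.subset_closure (by
              simp only [Set.mem_ofPred_eq, commList, List.mem_flatMap, List.mem_map]
              exact ⟨t, ht, s, hs, rfl⟩))
            rw [← hone] at h3
            simp only [comm₂, map_mul, map_inv] at h3
            have h4 : q s * q t * ((q t)⁻¹ * (q s)⁻¹ * q t * q s) = q t * q s := by group
            rw [h3, mul_one] at h4
            exact h4
          rw [SetLike.mem_coe, Subgroup.mem_comap, Subgroup.mem_center_iff]
          intro z
          obtain ⟨z, rfl⟩ := hqs z
          exact Subgroup.mem_centralizer_singleton_iff.mp (h2 (Subgroup.mem_top z))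
        · intro b hb
          rw [Subgroup.mem_comap, Subgroup.mem_center_iff]
          intro z
          obtain ⟨z, rfl⟩ := hqs z
          have := (hone _).mpr (hcomm b hb z)
          simp only [map_mul, map_inv] at this
          rwa [mul_inv_eq_one, mul_inv_eq_iff_eq_mul] at this
      exact h1
    change ⁅Γ i, ⊤⁆ ≤ B
    rw [Subgroup.commutator_le]
    intro y hy g _
    have := Subgroup.mem_center_iff.mp (hcent y hy) (q g)
    rw [← hone, map_commutatorElement, commutatorElement_eq_one_iff_mul_comm, this]

end Generators

/-- The length of a central cyclic series of an `r`-generated nilpotent group of class `c`. -/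
def seriesLength (r : ℕ) : ℕ → ℕ
  | 0 => 0
  | c + 1 => seriesLength r c + r ^ (c + 1)

theorem hasCentralCyclicSeries (r c : ℕ) : ∀ {G : Type u} [Group G] (l : List G), l.length = r →
    Subgroup.closure {a | a ∈ l} = ⊤ → (⊤ : Subgroup G).lowerCentralSeries c = ⊥ →
    HasCentralCyclicSeries (seriesLength r c) G := by
  induction c with
  | zero =>
    intro G _ l _ _ h
    exact (Subgroup.subsingleton_iff).mp (subsingleton_of_bot_eq_top h.symm)
  | succ c ih =>
    intro G _ l hlr hl h
    set A := (⊤ : Subgroup G).lowerCentralSeries c with hA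
    have hAcl := lowerCentralSeries_eq_closure_sup l hl c
    rw [h, sup_bot_eq] at hAcl
    have hq := QuotientGroup.mk'_surjective A
    refine hasCentralCyclicSeries_of_closure (r ^ (c + 1)) (QuotientGroup.mk' A) hq
      (commList l c) (by rw [length_commList, hlr]) ?_ ?_ ?_
    · intro a ha
      rw [Subgroup.mem_center_iff]
      intro g
      have := Subgroup.commutator_mem_commutator (commList_mem l c a ha) (Subgroup.mem_top g)
      change _ ∈ (⊤ : Subgroup G).lowerCentralSeries (c + 1) at this
      rw [h, Subgroup.mem_bot, commutatorElement_eq_one_iff_mul_comm] at this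
      exact this.symm
    · rw [QuotientGroup.ker_mk', hA, hAcl]
    · refine ih (l.map (QuotientGroup.mk' A)) (by simpa using hlr) ?_ ?_
      · have : {a | a ∈ l.map (QuotientGroup.mk' A)} = QuotientGroup.mk' A '' {a | a ∈ l} := by
          ext; simp
        rw [this, ← MonoidHom.map_closure, hl, ← MonoidHom.range_eq_map,
          MonoidHom.range_eq_top.mpr hq]
      · have := Subgroup.map_lowerCentralSeries (⊤ : Subgroup G) (QuotientGroup.mk' A) c
        rw [← MonoidHom.range_eq_map, MonoidHom.range_eq_top.mpr hq] at this
        rw [← this, ← hA, Subgroup.map_eq_bot_iff, QuotientGroup.ker_mk']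

theorem seriesLength_mono {r s : ℕ} (h : r ≤ s) (c : ℕ) : seriesLength r c ≤ seriesLength s c := by
  induction c with
  | zero => exact le_rfl
  | succ c ih => exact Nat.add_le_add ih (Nat.pow_le_pow_left h _)

theorem exists_hasCentralCyclicSeries {G : Type u} [Group G] [Group.FG G] {r c : ℕ}
    (hr : Group.rank G ≤ r) (h : (⊤ : Subgroup G).lowerCentralSeries c = ⊥) :
    ∃ N ≤ seriesLength r c, HasCentralCyclicSeries N G := by
  obtain ⟨S, hS, hcl⟩ := Group.rank_spec G
  refine ⟨_, ?_, hasCentralCyclicSeries S.card c S.toList (by simp) ?_ h⟩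
  · exact seriesLength_mono (hS.le.trans hr) c
  · simpa using hcl

/-- Two solutions of `g ^ e = 1` with the same image modulo the central cyclic subgroup differ by a
central element killed by `e`. A cyclic group has at most `e` of these, so each factor contributes
at most `e`. -/
theorem HasCentralCyclicSeries.card_torsion_le {e : ℕ} (he : 0 < e) (N : ℕ) :
    ∀ {G : Type u} [Group G], HasCentralCyclicSeries N G →
      Finite {g : G // g ^ e = 1} ∧ Nat.card {g : G // g ^ e = 1} ≤ e ^ N := by
  induction N with
  | zero =>
    intro G _ h
    have : Subsingleton G := h
    exact ⟨inferInstance, by simp⟩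
  | succ N ih =>
    intro G _ ⟨a, ha, K, _, f, hf, hker, hK⟩
    obtain ⟨hfin, hcard⟩ := ih hK
    have hzc : ∀ z ∈ Subgroup.zpowers a, ∀ g : G, Commute z g := fun z hz g =>
      (Subgroup.mem_center_iff.mp ((Subgroup.zpowers_le.mpr ha) hz) g).symm
    let Z : Subgroup G :=
      { carrier := {z | z ∈ Subgroup.zpowers a ∧ z ^ e = 1}
        one_mem' := ⟨Subgroup.one_mem _, one_pow e⟩
        mul_mem' := fun {x y} hx hy => ⟨Subgroup.mul_mem _ hx.1 hy.1, by
          rw [(hzc x hx.1 y).mul_pow, hx.2, hy.2, mul_one]⟩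
        inv_mem' := fun {x} hx => ⟨Subgroup.inv_mem _ hx.1, by rw [inv_pow, hx.2, inv_one]⟩ }
    have hZcyc : IsCyclic Z := Subgroup.isCyclic_of_le
      (show Z ≤ Subgroup.zpowers a from fun z hz => hz.1)
    have hexp : Monoid.exponent Z ∣ e :=
      Monoid.exponent_dvd_of_forall_pow_eq_one fun z => Subtype.ext z.2.2
    have hZcard : Nat.card Z ∣ e := IsCyclic.exponent_eq_card (α := Z) ▸ hexp
    have hZfin : Finite Z := Nat.finite_of_card_ne_zero fun h => by
      rw [h, zero_dvd_iff] at hZcard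
      omega
    let φ : {g : G // g ^ e = 1} → {g : K // g ^ e = 1} :=
      fun g => ⟨f g, by rw [← map_pow, g.2, map_one]⟩
    have : Nonempty {g : G // g ^ e = 1} := ⟨⟨1, one_pow e⟩⟩
    let s : {g : G // g ^ e = 1} → {g : G // g ^ e = 1} := fun g =>
      Function.invFun φ (φ g)
    have hs : ∀ g, φ (s g) = φ g := fun g => Function.invFun_eq ⟨g, rfl⟩
    have hmem : ∀ g, (s g : G)⁻¹ * g ∈ Subgroup.zpowers a := fun g => by
      rw [← hker, MonoidHom.mem_ker, map_mul, map_inv, inv_mul_eq_one]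
      exact congrArg Subtype.val (hs g)
    -- `s g` depends only on the image of `g`, so `g` is recovered from that image and the
    -- discrepancy `(s g)⁻¹ g`.
    let ψ : {g : G // g ^ e = 1} → {g : K // g ^ e = 1} × Z := fun g =>
      ⟨φ g, ⟨(s g : G)⁻¹ * g, hmem g, by
        have h1 := (hzc _ (hmem g) (s g)).mul_pow e
        have h2 : (s g : G)⁻¹ * g * (s g) = (s g) * ((s g : G)⁻¹ * g) := hzc _ (hmem g) (s g)
        rw [h2, mul_inv_cancel_left, g.2, (s g).2, mul_one] at h1
        exact h1.symm⟩⟩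
    have hψ : Function.Injective ψ := by
      intro g g' h
      have h1 : φ g = φ g' := congrArg Prod.fst h
      have h2 : (s g : G)⁻¹ * g = (s g' : G)⁻¹ * g' :=
        congrArg (fun x => (x.2 : G)) h
      have h3 : s g = s g' := by simp only [s, h1]
      rw [h3] at h2
      exact Subtype.ext (mul_left_cancel h2)
    refine ⟨Finite.of_injective ψ hψ, (Nat.card_le_card_of_injective ψ hψ).trans ?_⟩
    rw [Nat.card_prod, pow_succ]
    exact Nat.mul_le_mul hcard (Nat.le_of_dvd he hZcard)

theorem HasCentralCyclicSeries.fg (N : ℕ) :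
    ∀ {G : Type u} [Group G], HasCentralCyclicSeries N G → ∀ H : Subgroup G, H.FG := by
  induction N with
  | zero =>
    intro G _ h H
    have : Subsingleton G := h
    rw [Subsingleton.elim H ⊥]
    exact Subgroup.FG.bot
  | succ N ih =>
    intro G _ ⟨a, ha, K, _, f, hf, hker, hK⟩ H
    obtain ⟨T, hT⟩ := ih hK (H.map f)
    have hTH : ∀ t ∈ T, ∃ y ∈ H, f y = t := fun t ht => by
      have : t ∈ H.map f := hT ▸ Subgroup.subset_closure ht
      exact this
    choose! σ hσH hσ using hTH
    have hcyc : IsCyclic (H ⊓ Subgroup.zpowers a : Subgroup G) :=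
      Subgroup.isCyclic_of_le inf_le_right
    obtain ⟨b, hb⟩ := (Subgroup.isCyclic_iff_exists_zpowers_eq_top _).mp hcyc
    have hH : H = Subgroup.closure (σ '' T) ⊔ Subgroup.zpowers b := by
      rw [hb]
      refine le_antisymm (fun y hy => ?_) (sup_le ?_ inf_le_left)
      · have h1 : f y ∈ (Subgroup.closure (σ '' T)).map f := by
          rw [MonoidHom.map_closure, Set.image_image, Set.image_congr (g := id)
            (fun t ht => hσ t ht), Set.image_id, hT]
          exact Subgroup.mem_map_of_mem f hy
        obtain ⟨z, hz, hzy⟩ := h1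
        have hzH : z ∈ H := by
          refine (Subgroup.closure_le H).mpr ?_ hz
          rintro _ ⟨t, ht, rfl⟩
          exact hσH t ht
        rw [show y = z * (z⁻¹ * y) by group]
        refine Subgroup.mul_mem_sup hz ⟨H.mul_mem (H.inv_mem hzH) hy, ?_⟩
        rw [← hker]
        change f (z⁻¹ * y) = 1
        rw [map_mul, map_inv, hzy, inv_mul_cancel]
      · rw [Subgroup.closure_le]
        rintro _ ⟨t, ht, rfl⟩
        exact hσH t ht
    rw [hH]
    refine Subgroup.FG.sup ?_ ?_
    · exact (Subgroup.fg_iff _).mpr ⟨_, rfl, T.finite_toSet.image σ⟩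
    · exact (Subgroup.fg_iff _).mpr ⟨{b}, (Subgroup.zpowers_eq_closure b).symm,
        Set.finite_singleton b⟩

/-! ### Residual finiteness of finitely generated virtually nilpotent groups -/

theorem eq_one_of_forall_exists_root {Z : Type*} [CommGroup Z] [Group.FG Z] (z : Z)
    (h : ∀ k : ℕ, 0 < k → ∃ y, y ^ k = z) : z = 1 := by
  obtain ⟨ι, j, _, _, p, hp, e, ⟨φ⟩⟩ := CommGroup.equiv_free_prod_prod_multiplicative_zmod Z
  apply φ.injective
  rw [map_one]
  have h' : ∀ k : ℕ, 0 < k → ∃ y, y ^ k = φ z := fun k hk => by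
    obtain ⟨y, rfl⟩ := h k hk
    exact ⟨φ y, by simp⟩
  ext i
  · obtain ⟨y, hy⟩ := h' ((φ z).1 i).toAdd.natAbs.succ (Nat.succ_pos _)
    have h1 := congrArg (fun w => (w.1 i).toAdd) hy
    simp only [Prod.pow_fst, Pi.pow_apply, toAdd_pow, nsmul_eq_mul] at h1
    have h2 : ((φ z).1 i).toAdd = 0 := by
      refine Int.eq_zero_of_abs_lt_dvd (Dvd.intro _ h1) ?_
      rw [Int.abs_eq_natAbs]
      exact_mod_cast Nat.lt_succ_self _
    simpa using h2
  · have : NeZero (p i ^ e i) := ⟨pow_ne_zero _ (hp i).ne_zero⟩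
    obtain ⟨y, hy⟩ := h' (Nat.card (Multiplicative (ZMod (p i ^ e i)))) Nat.card_pos
    have h1 := congrArg (fun w => w.2 i) hy
    simp only [Prod.pow_snd, Pi.pow_apply, pow_card_eq_one'] at h1
    simpa using h1.symm

theorem exists_exponent_of_center (G : Type u) [Group G] [Group.IsNilpotent G] :
    ∀ k : ℕ, 0 < k → (∀ z ∈ Subgroup.center G, z ^ k = 1) → ∃ e : ℕ, 0 < e ∧ ∀ g : G, g ^ e = 1 := by
  refine Group.nilpotent_center_quotient_ind
    (P := fun G _ _ => ∀ k : ℕ, 0 < k → (∀ z ∈ Subgroup.center G, z ^ k = 1) →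
      ∃ e : ℕ, 0 < e ∧ ∀ g : G, g ^ e = 1) G ?_ ?_
  · intro G _ _ k _ _
    exact ⟨1, one_pos, fun g => Subsingleton.elim _ _⟩
  · intro G _ _ ih k hk hz
    have hone : ∀ y : G, QuotientGroup.mk' (Subgroup.center G) y = 1 ↔ y ∈ Subgroup.center G :=
      fun y => by rw [← MonoidHom.mem_ker, QuotientGroup.ker_mk']
    -- The centre of `G/Z(G)` is also killed by `k`: if all `[y, g]` are central, then `(y^k)^g = (y
    -- [y, g])^k = y^k [y, g]^k = y^k`, so `y^k` is central.
    obtain ⟨e, he, heq⟩ := ih k hk (by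
      intro y hy
      obtain ⟨y, rfl⟩ := QuotientGroup.mk'_surjective _ y
      rw [← map_pow, hone, Subgroup.mem_center_iff]
      intro g
      have h1 : comm₂ y g ∈ Subgroup.center G := by
        have := Subgroup.mem_center_iff.mp hy (QuotientGroup.mk' _ g)
        rw [← hone, map_comm₂, comm₂, mul_assoc, ← this]
        group
      have h2 : g⁻¹ * y * g = y * comm₂ y g := by simp [comm₂, mul_assoc]
      have h3 : (g⁻¹ * y * g) ^ k = y ^ k := by
        have hc : Commute y (comm₂ y g) := Subgroup.mem_center_iff.mp h1 y
        rw [h2, hc.mul_pow, hz _ h1, mul_one]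
      have h4 : (g⁻¹ * y * g) ^ k = g⁻¹ * y ^ k * g := by
        have := conj_pow (i := k) (a := g⁻¹) (b := y)
        rwa [inv_inv] at this
      rw [h4] at h3
      nth_rw 1 [← h3]
      group)
    refine ⟨e * k, Nat.mul_pos he hk, fun g => ?_⟩
    rw [pow_mul]
    apply hz
    rw [← hone, map_pow]
    exact heq _

/-- If no power `k > 0` killed `Z(M)`, then each `Z(M)^k` would be a nontrivial normal subgroup and
contain `g`. Then `g` would have roots of every order in the finitely generated abelian group
`Z(M)`, forcing `g = 1`. So `Z(M)` has finite exponent, hence so does `M`, and `card_torsion_le`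
makes `M` finite. -/
theorem finite_of_forall_mem_normal {Q : Type u} [Group Q] [Group.FG Q] {M : Subgroup Q}
    [M.Normal] [M.FiniteIndex] [Group.IsNilpotent M] {g : Q} (hg : g ≠ 1)
    (hmin : ∀ P : Subgroup Q, P.Normal → P ≠ ⊥ → g ∈ P) : Finite Q := by
  obtain ⟨c, hc⟩ := Subgroup.nilpotent_iff_lowerCentralSeries.mp ‹Group.IsNilpotent M›
  obtain ⟨N, -, hN⟩ := exists_hasCentralCyclicSeries (G := M) le_rfl hc
  suffices h : Finite M by
    have h1 := M.card_mul_index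
    have h2 : Nat.card Q ≠ 0 := by
      rw [← h1]
      exact mul_ne_zero Nat.card_pos.ne' Subgroup.FiniteIndex.index_ne_zero
    exact Nat.finite_of_card_ne_zero h2
  have key : ∃ k : ℕ, 0 < k ∧ ∀ z ∈ Subgroup.center M, z ^ k = 1 := by
    by_contra hcon
    push Not at hcon
    let _ : CommGroup (Subgroup.center M) :=
      { (inferInstance : Group (Subgroup.center M)) with
        mul_comm := fun a b => Subtype.ext (Subgroup.mem_center_iff.mp b.2 a) }
    have hfg : Group.FG (Subgroup.center M) := (Group.fg_iff_subgroup_fg _).mpr (hN.fg N _)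
    have hroot : ∀ k : ℕ, 0 < k → ∃ z : Subgroup.center M, ((z ^ k : M) : Q) = g := by
      intro k hk
      obtain ⟨z, hz, hzk⟩ := hcon k hk
      let P : Subgroup Q := (((powMonoidHom k : Subgroup.center M →* _).range).map
        (Subgroup.center M).subtype).map M.subtype
      have hmemP : ∀ y, y ∈ P ↔ ∃ z : Subgroup.center M, ((z ^ k : M) : Q) = y := by
        intro y
        constructor
        · rintro ⟨_, ⟨_, ⟨z, rfl⟩, rfl⟩, rfl⟩
          exact ⟨z, rfl⟩
        · rintro ⟨z, rfl⟩
          exact ⟨_, ⟨_, ⟨z, rfl⟩, rfl⟩, rfl⟩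
      have hPn : P.Normal := by
        refine ⟨fun y hy q => ?_⟩
        rw [hmemP] at hy ⊢
        obtain ⟨z, rfl⟩ := hy
        have hn : ((Subgroup.center M).map M.subtype).Normal := inferInstance
        obtain ⟨w, hw, hwz⟩ := hn.conj_mem (z : M) ⟨z, z.2, rfl⟩ q
        refine ⟨⟨w, hw⟩, ?_⟩
        rw [Subgroup.coe_subtype] at hwz
        simp only [Subgroup.coe_pow, hwz, conj_pow]
      refine (hmemP g).mp (hmin P hPn fun h => hzk ?_)
      have : ((z ^ k : M) : Q) ∈ P := (hmemP _).mpr ⟨⟨z, hz⟩, rfl⟩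
      rw [h, Subgroup.mem_bot] at this
      exact Subtype.ext this
    obtain ⟨z₀, hz₀⟩ := hroot 1 one_pos
    have hone : z₀ = 1 := by
      refine eq_one_of_forall_exists_root z₀ fun k hk => ?_
      obtain ⟨z, hz⟩ := hroot k hk
      refine ⟨z, Subtype.ext (Subtype.ext ?_)⟩
      rw [pow_one] at hz₀
      rw [hz₀, ← hz]
      rfl
    rw [hone] at hz₀
    exact hg (by simpa using hz₀.symm)
  obtain ⟨k, hk, hkz⟩ := key
  obtain ⟨e, he, heq⟩ := exists_exponent_of_center M k hk hkz
  obtain ⟨h1, -⟩ := hN.card_torsion_le he N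
  exact Finite.of_injective (fun x : M => (⟨x, heq x⟩ : {x : M // x ^ e = 1}))
    fun x y h => congrArg Subtype.val h

theorem exists_finiteIndex_notMem {G : Type u} [Group G] [Group.FG G] (M : Subgroup G) [M.Normal]
    [M.FiniteIndex] [Group.IsNilpotent M] {g : G} (hg : g ≠ 1) :
    ∃ N : Subgroup G, N.Normal ∧ N.FiniteIndex ∧ g ∉ N := by
  -- For `N` maximal among normal subgroups omitting `g`, every nontrivial normal subgroup of `G/N`
  -- contains the image of `g`.
  obtain ⟨N, hN⟩ := zorn_le₀ {N : Subgroup G | N.Normal ∧ g ∉ N} (by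
    intro C hC hchain
    rcases C.eq_empty_or_nonempty with rfl | hne
    · exact ⟨⊥, ⟨inferInstance, by simpa using hg⟩, by simp⟩
    · have hmem : ∀ x, x ∈ sSup C ↔ ∃ s ∈ C, x ∈ s := fun x =>
        Subgroup.mem_sSup_of_directedOn hne hchain.directedOn
      refine ⟨sSup C, ⟨⟨fun x hx q => ?_⟩, fun h => ?_⟩, fun s hs => le_sSup hs⟩
      · obtain ⟨s, hs, hx⟩ := (hmem x).mp hx
        exact (hmem _).mpr ⟨s, hs, (hC hs).1.conj_mem x hx q⟩
      · obtain ⟨s, hs, hx⟩ := (hmem g).mp h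
        exact (hC hs).2 hx)
  obtain ⟨hNn, hNg⟩ := hN.prop
  set q := QuotientGroup.mk' N with hq
  have hqs : Function.Surjective q := QuotientGroup.mk'_surjective N
  have h1 : (M.map q).Normal := Subgroup.Normal.map inferInstance q hqs
  have h2 : (M.map q).FiniteIndex := by
    refine ⟨fun h => ?_⟩
    have := Subgroup.index_map_dvd M hqs
    rw [h, zero_dvd_iff] at this
    exact Subgroup.FiniteIndex.index_ne_zero this
  have h3 : Group.IsNilpotent (M.map q) :=
    Group.nilpotent_of_surjective (q.subgroupMap M) (q.subgroupMap_surjective M)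
  have hfin : Finite (G ⧸ N) := by
    refine finite_of_forall_mem_normal (M := M.map q) (g := q g) (fun h => hNg ?_) ?_
    · rwa [← MonoidHom.mem_ker, hq, QuotientGroup.ker_mk'] at h
    · intro P hP hPb
      by_contra hgP
      have hle : N ≤ P.comap q := by
        intro x hx
        rw [← QuotientGroup.ker_mk' N] at hx
        rw [Subgroup.mem_comap, hq, MonoidHom.mem_ker.mp hx]
        exact P.one_mem
      have h4 := hN.le_of_ge (y := P.comap q) ⟨hP.comap q, hgP⟩ hle
      apply hPb
      rw [eq_bot_iff]
      intro y hy
      obtain ⟨x, rfl⟩ := hqs y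
      have h5 : x ∈ N := h4 hy
      rw [← QuotientGroup.ker_mk' N] at h5
      exact h5
  exact ⟨N, hNn, Subgroup.finiteIndex_of_finite_quotient, hNg⟩

/-- A finitely generated virtually nilpotent group has, for every finite set of nontrivial
elements, a finite quotient in which they all survive. -/
theorem exists_finiteIndex_disjoint {G : Type u} [Group G] [Group.FG G] (M : Subgroup G)
    [M.Normal] [M.FiniteIndex] [Group.IsNilpotent M] {S : Set G} (hS : S.Finite) :
    ∃ N : Subgroup G, N.Normal ∧ N.FiniteIndex ∧ ∀ g ∈ S, g ≠ 1 → g ∉ N := by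
  induction S, hS using Set.Finite.induction_on with
  | empty => exact ⟨⊤, inferInstance, inferInstance, by simp⟩
  | @insert a S _ _ ih =>
    obtain ⟨N, h1, h2, h3⟩ := ih
    by_cases ha : a = 1
    · refine ⟨N, h1, h2, ?_⟩
      rintro g (rfl | hg) hne
      · exact absurd ha hne
      · exact h3 g hg hne
    · obtain ⟨N', h1', h2', h3'⟩ := exists_finiteIndex_notMem M ha
      refine ⟨N ⊓ N', inferInstance, inferInstance, ?_⟩
      rintro g (rfl | hg) hne h
      · exact h3' h.2
      · exact h3 g hg hne h.1

/-! ### Coprime powers of commutators in finite groups, by class sums -/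

section PowerClosure

variable {G : Type*} [Group G]

/-- A family of group elements that is closed under conjugation, counted with multiplicity. -/
def ConjInvariant {I : Type*} (φ : I → G) : Prop :=
  ∀ g : G, ∃ σ : Equiv.Perm I, ∀ i, φ (σ i) = g * φ i * g⁻¹

theorem ConjInvariant.comp_hom_pow {I : Type*} {φ : I → G} (h : ConjInvariant φ) (k : ℕ) :
    ConjInvariant fun i => φ i ^ k := by
  intro g
  obtain ⟨σ, hσ⟩ := h g
  exact ⟨σ, fun i => by simp only [hσ, conj_pow]⟩

theorem ConjInvariant.mul {I J : Type*} {φ : I → G} {ψ : J → G} (h : ConjInvariant φ)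
    (h' : ConjInvariant ψ) : ConjInvariant fun i : I × J => φ i.1 * ψ i.2 := by
  intro g
  obtain ⟨σ, hσ⟩ := h g
  obtain ⟨τ, hτ⟩ := h' g
  exact ⟨σ.prodCongr τ, fun i => by simp [hσ, hτ]⟩

theorem ConjInvariant.list_prod {I : Type*} {φ : I → G} (h : ConjInvariant φ) (n : ℕ) :
    ConjInvariant fun f : Fin n → I => (List.ofFn fun i => φ (f i)).prod := by
  intro g
  obtain ⟨σ, hσ⟩ := h g
  refine ⟨(Equiv.refl (Fin n)).arrowCongr σ, fun f => ?_⟩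
  have h1 := map_list_prod (MulAut.conj g) (List.ofFn fun i => φ (f i))
  rw [MulAut.conj_apply] at h1
  rw [h1, List.map_ofFn]
  change (List.ofFn _).prod = _
  congr 2
  funext i
  simp [hσ]

/-- The sum of a family of group elements in the group algebra over `ZMod p`. -/
noncomputable def classSum (p : ℕ) {I : Type*} [Fintype I] (φ : I → G) :
    MonoidAlgebra (ZMod p) G := ∑ i, MonoidAlgebra.single (φ i) 1

theorem coeff_classSum {H : Type*} (p : ℕ) {I : Type*} [Fintype I] (φ : I → H) (y : H) :
    (classSum p φ).coeff y = (Nat.card {i // φ i = y} : ZMod p) := by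
  classical
  rw [classSum, MonoidAlgebra.coeff_sum, Finsupp.finsetSum_apply, Nat.card_eq_fintype_card,
    Fintype.card_subtype, ← Finset.sum_boole]
  refine Finset.sum_congr rfl fun i _ => ?_
  rw [MonoidAlgebra.coeff_single, Finsupp.single_apply]

theorem classSum_mul (p : ℕ) {I J : Type*} [Fintype I] [Fintype J] (φ : I → G) (ψ : J → G) :
    classSum p φ * classSum p ψ = classSum p fun i : I × J => φ i.1 * ψ i.2 := by
  simp only [classSum, Finset.sum_mul_sum, MonoidAlgebra.single_mul_single, mul_one]
  rw [Fintype.sum_prod_type]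

theorem ConjInvariant.commute_classSum (p : ℕ) {I J : Type*} [Fintype I] [Fintype J] {φ : I → G}
    (h : ConjInvariant φ) (ψ : J → G) : Commute (classSum p φ) (classSum p ψ) := by
  choose σ hσ using h
  simp only [Commute, SemiconjBy, classSum, Finset.sum_mul_sum, MonoidAlgebra.single_mul_single,
    mul_one]
  rw [Finset.sum_comm]
  refine Finset.sum_congr rfl fun j _ => ?_
  rw [← Equiv.sum_comp (σ (ψ j))]
  refine Finset.sum_congr rfl fun i _ => ?_
  rw [hσ, inv_mul_cancel_right]

theorem classSum_pow (p : ℕ) {I : Type*} [Fintype I] (φ : I → G) (n : ℕ) :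
    classSum p φ ^ n =
      classSum p fun f : Fin n → I => (List.ofFn fun i => φ (f i)).prod := by
  induction n with
  | zero => simp [classSum, MonoidAlgebra.one_def]
  | succ n ih =>
    rw [pow_succ', ih, classSum_mul]
    unfold classSum
    refine Fintype.sum_equiv (Fin.consEquiv fun _ => I) _ _ fun f => ?_
    simp [Fin.consEquiv, List.ofFn_succ]

theorem isConj_prod_rotate {I : Type*} (φ : I → G) (n : ℕ) (f : Fin (n + 1) → I) :
    IsConj (List.ofFn fun i => φ (f i)).prod (List.ofFn fun i => φ (f (i + 1))).prod := by
  have h1 : (fun i : Fin (n + 1) => φ (f (i + 1))) =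
      @Fin.snoc n (fun _ => G) (fun i => φ (f i.succ)) (φ (f 0)) := by
    rw [Fin.snoc_eq_cons_rotate]
    funext i
    rw [finRotate_apply]
    generalize i + 1 = j
    cases j using Fin.cases <;> simp
  rw [h1, List.ofFn_succ, List.ofFn_succ', isConj_iff]
  refine ⟨(φ (f 0))⁻¹, ?_⟩
  simp

-- The cyclic group of order `p` rotates the `p`-tuples, and rotation preserves the conjugacy class
-- of the product. The fixed points are the constant tuples, and all other orbits have length `p`.
open scoped Fin.NatCast in
theorem card_conj_prod_modEq {I : Type*} [Finite I] (φ : I → G) {p : ℕ} (hp : p.Prime) (y : G) :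
    Nat.card {f : Fin p → I // IsConj y (List.ofFn fun i => φ (f i)).prod} ≡
      Nat.card {i // IsConj y (φ i ^ p)} [MOD p] := by
  classical
  have := Fintype.ofFinite I
  obtain ⟨n, rfl⟩ : ∃ n, p = n + 1 := ⟨p - 1, (Nat.succ_pred_prime hp).symm⟩
  have : Fact (n + 1).Prime := ⟨hp⟩
  let T := {f : Fin (n + 1) → I // IsConj y (List.ofFn fun i => φ (f i)).prod}
  have : Fintype T := Fintype.ofFinite T
  let ρ : Function.End T := fun f =>
    ⟨fun i => f.1 (i + 1), f.2.trans (isConj_prod_rotate φ n f.1)⟩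
  have hiter : ∀ k : ℕ, ∀ f : T, ∀ i, ((ρ ^ k) f).1 i = f.1 (i + (k : Fin (n + 1))) := by
    intro k
    induction k with
    | zero =>
      intro f i
      rw [Nat.cast_zero, add_zero]
      rfl
    | succ k ih =>
      intro f i
      rw [pow_succ']
      change ((ρ ^ k) f).1 (i + 1) = _
      rw [ih, Nat.cast_succ, add_assoc, add_comm 1]
  have hρ : ρ ^ (n + 1) ^ 1 = 1 := by
    funext f
    apply Subtype.ext
    funext i
    rw [pow_one, hiter, Fin.natCast_self, add_zero]
    rfl
  have hmod := Equiv.Perm.card_fixedPoints_modEq hρ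
  rw [← Nat.card_eq_fintype_card, ← Nat.card_eq_fintype_card] at hmod
  refine hmod.trans ?_
  have hconst : ∀ f : T, f ∈ Function.fixedPoints ρ → ∀ i, f.1 i = f.1 0 := by
    intro f hf i
    have h1 : ∀ k : ℕ, (ρ ^ k) f = f := by
      intro k
      induction k with
      | zero => rfl
      | succ k ih =>
        rw [pow_succ]
        change (ρ ^ k) (ρ f) = f
        rw [show ρ f = f from hf, ih]
    have h2 := hiter i.val f 0
    rw [h1, zero_add, Fin.cast_val_eq_self] at h2
    exact h2.symm
  have hprod : ∀ i : I, (List.ofFn fun _ : Fin (n + 1) => φ i).prod = φ i ^ (n + 1) := by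
    intro i
    rw [List.ofFn_const, List.prod_replicate]
  have hcard : Nat.card (Function.fixedPoints ρ) = Nat.card {i // IsConj y (φ i ^ (n + 1))} := by
    refine Nat.card_congr
      { toFun := fun f => ⟨f.1.1 0, ?_⟩
        invFun := fun i => ⟨⟨fun _ => i.1, ?_⟩, ?_⟩
        left_inv := ?_
        right_inv := ?_ }
    · have h1 := f.1.2
      rw [← hprod]
      rwa [show (fun i => φ (f.1.1 i)) = fun _ => φ (f.1.1 0) from
        funext fun i => by rw [hconst f.1 f.2 i]] at h1
    · rw [hprod]
      exact i.2
    · rfl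
    · intro f
      apply Subtype.ext
      apply Subtype.ext
      funext i
      exact (hconst f.1 f.2 i).symm
    · intro i
      rfl
  rw [hcard]

theorem ConjInvariant.card_conj {I : Type*} [Finite I] [Finite G] {φ : I → G}
    (h : ConjInvariant φ) (y : G) :
    Nat.card {i // IsConj y (φ i)} = Nat.card {z // IsConj y z} * Nat.card {i // φ i = y} := by
  have := Fintype.ofFinite {z // IsConj y z}
  have e : {i // IsConj y (φ i)} ≃ Σ z : {z // IsConj y z}, {i // φ i = z.1} :=
    { toFun := fun i => ⟨⟨φ i.1, i.2⟩, ⟨i.1, rfl⟩⟩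
      invFun := fun i => ⟨i.2.1, by rw [i.2.2]; exact i.1.2⟩
      left_inv := fun i => rfl
      right_inv := by
        rintro ⟨⟨z, hz⟩, ⟨i, hi⟩⟩
        change φ i = z at hi
        subst hi
        rfl }
  rw [Nat.card_congr e, Nat.card_sigma, Nat.card_eq_fintype_card, ← smul_eq_mul,
    ← Finset.card_univ, ← Finset.sum_const]
  refine Finset.sum_congr rfl fun z _ => ?_
  obtain ⟨g, hg⟩ := isConj_iff.mp z.2
  obtain ⟨σ, hσ⟩ := h g
  refine (Nat.card_congr (σ.subtypeEquiv fun i => ?_)).symm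
  rw [hσ, ← hg]
  constructor
  · rintro rfl
    rfl
  · intro h
    exact mul_left_cancel (mul_right_cancel h)

/-- In characteristic `p` larger than the order of the group, the `p`-th power of a class sum is
the sum of the `p`-th powers. -/
theorem ConjInvariant.classSum_pow_prime {I : Type*} [Fintype I] [Finite G] {φ : I → G}
    (h : ConjInvariant φ) {p : ℕ} (hp : p.Prime) (hG : Nat.card G < p) :
    classSum p φ ^ p = classSum p fun i => φ i ^ p := by
  have : Fact p.Prime := ⟨hp⟩
  rw [classSum_pow]
  refine MonoidAlgebra.ext (Finsupp.ext fun y => ?_)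
  rw [coeff_classSum, coeff_classSum]
  have h1 := (h.list_prod p).card_conj y
  have h2 := (h.comp_hom_pow p).card_conj y
  have h3 := (ZMod.natCast_eq_natCast_iff _ _ _).mpr (card_conj_prod_modEq φ hp y)
  rw [h1, h2, Nat.cast_mul, Nat.cast_mul] at h3
  -- The rotation count concerns whole conjugacy classes. The size of the class of `y` can be
  -- cancelled modulo `p`, because it is positive and smaller than `p`.
  refine mul_left_cancel₀ ?_ h3
  rw [Ne, ZMod.natCast_eq_zero_iff]
  have : Nonempty {z // IsConj y z} := ⟨⟨y, IsConj.refl y⟩⟩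
  refine Nat.not_dvd_of_pos_of_lt Nat.card_pos (lt_of_le_of_lt ?_ hG)
  exact Nat.card_le_card_of_injective _ Subtype.val_injective

theorem conjInvariant_isConj (a : G) : ConjInvariant (fun z : {z // IsConj a z} => z.1) := by
  intro g
  refine ⟨(MulAut.conj g).toEquiv.subtypeEquiv fun z => ?_, fun z => by simp [MulAut.conj_apply]⟩
  have h1 : IsConj z (MulAut.conj g z) := isConj_iff.mpr ⟨g, by simp [MulAut.conj_apply]⟩
  exact ⟨fun h => h.trans h1, fun h => h.trans h1.symm⟩

/-- In a finite group, if `k` is coprime to the order, the `k`-th power of a product lies in the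
product of the classes of the `k`-th powers. -/
theorem exists_isConj_pow_mul [Finite G] {k : ℕ} (hk : k.Coprime (Nat.card G)) (a b : G) :
    ∃ a' b', IsConj (a ^ k) a' ∧ IsConj (b ^ k) b' ∧ a' * b' = (a * b) ^ k := by
  classical
  have := Fintype.ofFinite G
  -- Dirichlet's theorem gives a prime `p ≡ k` modulo `|G|`, so `p`-th and `k`-th powers agree.
  -- Taking `p > |G|²` ensures that a positive number of pairs stays nonzero modulo `p`.
  obtain ⟨p, hpG, hp, hpk⟩ := Nat.forall_exists_prime_gt_and_modEq (Nat.card G * Nat.card G)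
    (Nat.card_pos (α := G)).ne' hk
  have hpow : ∀ y : G, y ^ p = y ^ k := fun y =>
    pow_eq_pow_iff_modEq.mpr (hpk.of_dvd (orderOf_dvd_natCard y))
  have hcop : (Nat.card G).Coprime p := by
    rw [Nat.coprime_comm, Nat.coprime_iff_gcd_eq_one, hpk.gcd_eq]
    exact hk
  have hinj : ∀ y z : G, y ^ p = z ^ p → y = z := fun y z h => (powCoprime hcop).injective h
  have hGp : Nat.card G < p := lt_of_le_of_lt (Nat.le_mul_self _) hpG
  let φ : {z // IsConj a z} → G := fun z => z.1
  let ψ : {z // IsConj b z} → G := fun z => z.1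
  have hφ : ConjInvariant φ := conjInvariant_isConj a
  have hψ : ConjInvariant ψ := conjInvariant_isConj b
  -- Comparing coefficients of `(a b)^p` in `(A B)^p = A^p B^p` for the class sums `A` and `B`: the
  -- left coefficient counts a nonempty set of fewer than `p` pairs, so the right one is nonzero as
  -- well.
  have key := (hφ.commute_classSum p ψ).mul_pow p
  rw [classSum_mul, (hφ.mul hψ).classSum_pow_prime hp hGp, hφ.classSum_pow_prime hp hGp,
    hψ.classSum_pow_prime hp hGp, classSum_mul] at key
  have h1 := DFunLike.congr_fun (congrArg MonoidAlgebra.coeff key) ((a * b) ^ p)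
  rw [coeff_classSum, coeff_classSum] at h1
  have hne : Nonempty {i : {z // IsConj a z} × {z // IsConj b z} //
      (φ i.1 * ψ i.2) ^ p = (a * b) ^ p} :=
    ⟨⟨⟨a, IsConj.refl a⟩, ⟨b, IsConj.refl b⟩⟩, rfl⟩
  have h2 : ((Nat.card {i : {z // IsConj a z} × {z // IsConj b z} //
      (φ i.1 * ψ i.2) ^ p = (a * b) ^ p} : ℕ) : ZMod p) ≠ 0 := by
    rw [Ne, ZMod.natCast_eq_zero_iff]
    refine Nat.not_dvd_of_pos_of_lt Nat.card_pos (lt_of_le_of_lt ?_ hpG)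
    rw [← Nat.card_prod]
    refine Nat.card_le_card_of_injective (fun i => ((i.1.1.1, i.1.2.1) : G × G)) ?_
    rintro ⟨⟨⟨x, _⟩, ⟨y, _⟩⟩, _⟩ ⟨⟨⟨x', _⟩, ⟨y', _⟩⟩, _⟩ h
    obtain ⟨rfl, rfl⟩ := Prod.mk.inj h
    rfl
  rw [h1] at h2
  have h3 : Nat.card {i : {z // IsConj a z} × {z // IsConj b z} //
      φ i.1 ^ p * ψ i.2 ^ p = (a * b) ^ p} ≠ 0 := fun h => h2 (by rw [h, Nat.cast_zero])
  obtain ⟨⟨⟨⟨x, hx⟩, ⟨y, hy⟩⟩, hxy⟩⟩ := (Nat.card_ne_zero.mp h3).1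
  refine ⟨x ^ k, y ^ k, hx.pow k, hy.pow k, ?_⟩
  rw [← hpow, ← hpow, ← hpow]
  exact hxy

/-- Write `[w, c] = w⁻¹ w^c`. Its `k`-th power is a product of conjugates of `w^{-k}` and `w^k`,
hence a conjugate of some `[w^k, c']`, and `w^k` is a shorter commutator by induction. -/
theorem pow_mem_commutatorsOfLength [Finite G] {k ℓ : ℕ} (hk : k.Coprime (Nat.card G))
    (hℓ : 0 < ℓ) : ∀ y ∈ commutatorsOfLength G ℓ, y ^ k ∈ commutatorsOfLength G ℓ := by
  induction ℓ, hℓ using Nat.le_induction with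
  | base => exact fun y _ => ⟨[y ^ k], rfl, rfl⟩
  | succ ℓ hℓ ih =>
    intro y hy
    obtain ⟨u, g, hg, rfl⟩ := (mem_commutatorsOfLength_iff (Nat.succ_pos ℓ)).mp hy
    obtain ⟨g, c, rfl⟩ : ∃ g' c, g = g' ++ [c] := by
      rcases List.eq_nil_or_concat g with rfl | ⟨g', c, rfl⟩
      · simp at hg; omega
      · exact ⟨g', c, by simp⟩
    set w := iterComm g u with hw
    have hwL : w ∈ commutatorsOfLength G ℓ :=
      (mem_commutatorsOfLength_iff hℓ).mpr ⟨u, g, by simpa using hg, rfl⟩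
    rw [iterComm_append]
    change (comm₂ w c) ^ k ∈ _
    obtain ⟨a, b, ha, hb, hab⟩ := exists_isConj_pow_mul hk w⁻¹ (cj c w)
    have h1 : comm₂ w c = w⁻¹ * cj c w := by simp [comm₂, cj_apply, mul_assoc]
    rw [h1, ← hab]
    rw [isConj_iff] at ha hb
    obtain ⟨s, rfl⟩ := ha
    obtain ⟨t, rfl⟩ := hb
    have h2 : s * w⁻¹ ^ k * s⁻¹ * (t * cj c w ^ k * t⁻¹) =
        cj s⁻¹ (comm₂ (w ^ k) (c * t⁻¹ * s)) := by
      rw [← map_pow]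
      simp only [comm₂, cj_apply, inv_pow]
      group
    rw [h2]
    refine map_mem_commutatorsOfLength _ ?_
    obtain ⟨v, h, hh, hv⟩ := (mem_commutatorsOfLength_iff hℓ).mp (ih w hwL)
    refine (mem_commutatorsOfLength_iff (Nat.succ_pos ℓ)).mpr
      ⟨v, h ++ [c * t⁻¹ * s], by simpa using hh, ?_⟩
    rw [iterComm_append, hv]
    rfl

end PowerClosure

/-! ### Bounding the maximal order -/

section OrderBound

/-- For a prime power `p^k` dividing `n` with `k > 0`, `p^(k-1) (p-1) ≤ φ(n) ≤ m`, so `p^k ≤ 2m` and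
`p^k` divides `(2m)!`. -/
theorem dvd_factorial_of_totient_le {n m : ℕ} (hn : 0 < n) (h : n.totient ≤ m) :
    n ∣ (2 * m).factorial := by
  refine (Nat.dvd_iff_prime_pow_dvd_dvd _ _).mpr fun p k hp hpk => ?_
  rcases Nat.eq_zero_or_pos k with rfl | hk
  · simp
  refine Nat.dvd_factorial (pow_pos hp.pos k) ?_
  have h1 : (p ^ k).totient ≤ m :=
    (Nat.le_of_dvd (Nat.totient_pos.mpr hn) (Nat.totient_dvd_of_dvd hpk)).trans h
  rw [Nat.totient_prime_pow hp hk] at h1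
  obtain ⟨k, rfl⟩ : ∃ j, k = j + 1 := ⟨k - 1, by omega⟩
  rw [Nat.add_sub_cancel] at h1
  have h2 : p ≤ 2 * (p - 1) := by have := hp.two_le; omega
  calc p ^ (k + 1) = p ^ k * p := pow_succ _ _
    _ ≤ p ^ k * (2 * (p - 1)) := Nat.mul_le_mul_left _ h2
    _ = 2 * (p ^ k * (p - 1)) := by ring
    _ ≤ 2 * m := Nat.mul_le_mul_left _ h1

theorem orderOf_mk'_eq {G : Type*} [Group G] {N : Subgroup G} [N.Normal] {x : G} {n : ℕ}
    (hn : 0 < n) (hxn : orderOf x = n) (h : ∀ k < n, x ^ k ≠ 1 → x ^ k ∉ N) :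
    orderOf (QuotientGroup.mk' N x) = n := by
  have hdvd : orderOf (QuotientGroup.mk' N x) ∣ n := hxn ▸ orderOf_map_dvd _ x
  refine le_antisymm (Nat.le_of_dvd hn hdvd) ?_
  by_contra! hlt
  have hpos := Nat.pos_of_dvd_of_pos hdvd hn
  refine h _ hlt ?_ ?_
  · rw [← hxn] at hlt
    exact pow_ne_one_of_lt_orderOf hpos.ne' hlt
  · have h1 := pow_orderOf_eq_one (QuotientGroup.mk' N x)
    rw [← map_pow] at h1
    exact (QuotientGroup.eq_one_iff _).mp h1

/-- In a finite quotient where `x` keeps its order `n`, each `x^k` with `k` coprime to `n` is a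
commutator. Any lift to a commutator of `G` has order divisible by `n`, hence equal to `n`, and
distinct residues `k` give distinct lifts. -/
theorem totient_le_ncard_commutatorsOfOrder {G : Type u} [Group G] [Group.FG G] (M : Subgroup G)
    [M.Normal] [M.FiniteIndex] [Group.IsNilpotent M] {ℓ n : ℕ} (hℓ : 0 < ℓ) (hn : 0 < n)
    (hmax : IsMaximalCommutatorOrder G ℓ n) (hfin : (commutatorsOfOrder G ℓ n).Finite) :
    n.totient ≤ (commutatorsOfOrder G ℓ n).ncard := by
  obtain ⟨x, hxL, hxn⟩ := hmax.2
  obtain ⟨N, hN, hNfin, hS⟩ := exists_finiteIndex_disjoint M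
    (S := (fun k => x ^ k) '' (Finset.range n : Set ℕ)) ((Finset.finite_toSet _).image _)
  let π := QuotientGroup.mk' N
  have hord : orderOf (π x) = n :=
    orderOf_mk'_eq hn hxn fun k hk => hS (x ^ k) ⟨k, by simpa using hk, rfl⟩
  have key : ∀ k ∈ (Finset.range n).filter n.Coprime,
      ∃ y ∈ commutatorsOfOrder G ℓ n, π y = π x ^ k := by
    intro k hk
    rw [Finset.mem_filter] at hk
    -- The exponent `k` is coprime only to `n`. A large prime `q ≡ k` modulo `n` gives the same
    -- power of `x` and is coprime to the order of the quotient.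
    obtain ⟨q, hq, hqp, hqk⟩ := Nat.forall_exists_prime_gt_and_modEq (Nat.card (G ⧸ N)) hn.ne'
      hk.2.symm
    have hqcop : q.Coprime (Nat.card (G ⧸ N)) :=
      (Nat.Prime.coprime_iff_not_dvd hqp).mpr (Nat.not_dvd_of_pos_of_lt Nat.card_pos hq)
    have hpow : π x ^ q = π x ^ k := pow_eq_pow_iff_modEq.mpr (by rwa [hord])
    obtain ⟨y, hy, hyq⟩ := exists_of_mem_commutatorsOfLength π (QuotientGroup.mk'_surjective N)
      (pow_mem_commutatorsOfLength hqcop hℓ (π x) (map_mem_commutatorsOfLength π hxL))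
    refine ⟨y, ⟨hy, orderOf_eq_of_dvd (hmax.1 y hy) ?_⟩, hyq.trans hpow⟩
    have h1 : orderOf (π y) = n := by
      rw [hyq, hpow, Nat.Coprime.orderOf_pow, hord]
      rw [hord]
      exact hk.2
    exact h1 ▸ orderOf_map_dvd π y
  choose! f hf hfk using key
  rw [Nat.totient_eq_card_coprime, ← Set.ncard_coe_finset]
  refine Set.ncard_le_ncard_of_injOn f hf (fun i hi j hj hij => ?_) hfin
  have h1 : π x ^ i = π x ^ j := by rw [← hfk i hi, ← hfk j hj, hij]
  rw [pow_eq_pow_iff_modEq, hord] at h1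
  simp only [Finset.coe_filter, Finset.mem_range, Set.mem_ofPred_eq] at hi hj
  exact h1.eq_of_lt_of_lt hi.1 hj.1

end OrderBound

/-! ### Generation of `γ_ℓ` by commutators, and Dietzmann's lemma -/

section Dietzmann

theorem lowerCentralSeries_eq_closure {G : Type*} [Group G] {ℓ : ℕ} (hℓ : 0 < ℓ) :
    (⊤ : Subgroup G).lowerCentralSeries (ℓ - 1) = Subgroup.closure (commutatorsOfLength G ℓ) := by
  induction ℓ, hℓ using Nat.le_induction with
  | base =>
    refine ((Subgroup.eq_top_iff' _).mpr fun x => ?_).symm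
    exact Subgroup.subset_closure ⟨[x], rfl, rfl⟩
  | succ ℓ hℓ ih =>
    obtain ⟨ℓ, rfl⟩ : ∃ j, ℓ = j + 1 := ⟨ℓ - 1, by omega⟩
    rw [Nat.add_sub_cancel] at ih ⊢
    set K := Subgroup.closure (commutatorsOfLength G (ℓ + 1 + 1)) with hK
    have hKn : K.Normal := closure_normal fun d s hs => map_mem_commutatorsOfLength _ hs
    refine le_antisymm ?_ ?_
    · rw [Subgroup.lowerCentralSeries_succ, ih]
      have hle : Subgroup.closure (commutatorsOfLength G (ℓ + 1)) ≤
          (Subgroup.center (G ⧸ K)).comap (QuotientGroup.mk' K) := by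
        rw [Subgroup.closure_le]
        intro y hy
        obtain ⟨u, g, hg, rfl⟩ := (mem_commutatorsOfLength_iff (Nat.succ_pos ℓ)).mp hy
        rw [SetLike.mem_coe, Subgroup.mem_comap, Subgroup.mem_center_iff]
        intro c
        obtain ⟨c, rfl⟩ := QuotientGroup.mk'_surjective K c
        rw [← map_mul, ← map_mul, QuotientGroup.mk'_eq_mk']
        refine ⟨comm₂ (iterComm g u) c, ?_, by simp [comm₂, mul_assoc]⟩
        refine hK ▸ Subgroup.subset_closure ((mem_commutatorsOfLength_iff (Nat.succ_pos _)).mpr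
          ⟨u, g ++ [c], by simpa using hg, ?_⟩)
        rw [iterComm_append]
        rfl
      refine Subgroup.commutator_le.mpr fun a ha b _ => ?_
      have h1 := Subgroup.mem_center_iff.mp (Subgroup.mem_comap.mp (hle ha)) (QuotientGroup.mk' K b)
      rw [← QuotientGroup.ker_mk' K, MonoidHom.mem_ker, map_commutatorElement, commutatorElement_def,
        ← h1]
      group
    · rw [hK, Subgroup.closure_le]
      intro y hy
      obtain ⟨u, g, hg, rfl⟩ := (mem_commutatorsOfLength_iff (Nat.succ_pos _)).mp hy
      obtain ⟨g, c, rfl⟩ : ∃ g' c, g = g' ++ [c] := by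
        rcases List.eq_nil_or_concat g with rfl | ⟨g', c, rfl⟩
        · simp at hg
        · exact ⟨g', c, by simp⟩
      rw [iterComm_append]
      have h1 : iterComm g u ∈ (⊤ : Subgroup G).lowerCentralSeries ℓ := by
        rw [ih]
        exact Subgroup.subset_closure ((mem_commutatorsOfLength_iff (Nat.succ_pos _)).mpr
          ⟨u, g, by simpa using hg, rfl⟩)
      have := Subgroup.commutator_mem_commutator (Subgroup.inv_mem _ h1) (Subgroup.mem_top c⁻¹)
      simpa [commutatorElement_def, comm₂] using! this

/-- A bound for the order of a group generated by a normal set of `k` elements whose orders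
divide `e`. -/
def normalClosureBound (k e : ℕ) : ℕ :=
  ((k + 1) ^ k) ^ ((k + 1) ^ k * e ^ k * k) * ((k + 1) ^ k * e ^ k)

open scoped IsMulCommutative in
/-- Dietzmann's lemma: a finite normal set of elements of finite order generates
a finite subgroup. -/
theorem card_le_of_closure_eq_top {K : Type*} [Group K] {S : Set K} (hS : S.Finite)
    (hcj : ∀ d, ∀ s ∈ S, cj d s ∈ S) (hcl : Subgroup.closure S = ⊤) {k e : ℕ} (hk : S.ncard ≤ k)
    (he : 0 < e) (hpow : ∀ s ∈ S, s ^ e = 1) :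
    Finite K ∧ Nat.card K ≤ normalClosureBound k e := by
  have : Group.FG K := Group.fg_iff.mpr ⟨S, hcl, hS⟩
  have hrank : Group.rank K ≤ k := by
    have h1 : Subgroup.closure ((hS.toFinset : Finset K) : Set K) = ⊤ := by simpa using hcl
    refine (Group.rank_le h1).trans ?_
    rwa [← Set.ncard_eq_toFinset_card S hS]
  have hcenter : Subgroup.centralizer S = Subgroup.center K := by
    rw [← Subgroup.centralizer_closure, hcl, Subgroup.coe_top, Subgroup.centralizer_univ]
  obtain ⟨hc1, hc2⟩ := centralizer_finiteIndex hcj hS hk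
  rw [hcenter] at hc1 hc2
  set c := (Subgroup.center K).index with hc
  have habel : ∀ q : Abelianization K, q ^ e = 1 := by
    have hle : (⊤ : Subgroup K) ≤ ((powMonoidHom e).comp (Abelianization.of (G := K))).ker := by
      rw [← hcl, Subgroup.closure_le]
      intro s hs
      rw [SetLike.mem_coe, MonoidHom.mem_ker, MonoidHom.comp_apply, powMonoidHom_apply, ← map_pow,
        hpow s hs, map_one]
    intro q
    obtain ⟨y, rfl⟩ := QuotientGroup.mk_surjective q
    exact hle (Subgroup.mem_top y)
  have : Group.FG (Abelianization K) := QuotientGroup.fg (commutator K)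
  have hab := card_dvd_exponent_pow_rank' (Abelianization K) habel
  have hrab : Group.rank (Abelianization K) ≤ k :=
    (Group.rank_le_of_surjective (Abelianization.of (G := K))
      (QuotientGroup.mk_surjective)).trans hrank
  have hidx : (commutator K).index ∣ e ^ Group.rank (Abelianization K) := hab
  have hidx0 : (commutator K).index ≠ 0 := fun h => by
    rw [h, zero_dvd_iff] at hidx
    exact (pow_pos he _).ne' hidx
  have hidx1 : (commutator K).index ≤ e ^ k :=
    (Nat.le_of_dvd (pow_pos he _) hidx).trans (Nat.pow_le_pow_right he hrab)
  have : (commutator K).FiniteIndex := ⟨hidx0⟩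
  set A := Subgroup.center K ⊓ commutator K with hA
  have hAidx : A.index ≤ (k + 1) ^ k * e ^ k :=
    Subgroup.index_inf_le.trans (Nat.mul_le_mul hc2 hidx1)
  let : CommGroup A := { (inferInstance : Group A) with
    mul_comm := fun a b => Subtype.ext (Subgroup.mem_center_iff.mp b.2.1 a) }
  -- The transfer into the centre is `y ↦ y^c` with `c` the index of the centre. Its target is
  -- abelian, so it kills the derived subgroup.
  have hApow : ∀ a : A, a ^ c = 1 := by
    intro a
    have h1 := Abelianization.commutator_subset_ker (MonoidHom.transferCenterPow K) a.2.2
    apply Subtype.ext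
    simpa only [MonoidHom.mem_ker, Subtype.ext_iff] using! h1
  have hAdvd := card_dvd_exponent_pow_rank' A hApow
  have hcpos : 0 < c := Nat.pos_of_ne_zero hc1.index_ne_zero
  have hAcard0 : Nat.card A ≠ 0 := fun h => by
    rw [h, zero_dvd_iff] at hAdvd
    exact (pow_pos hcpos _).ne' hAdvd
  have hArank : Group.rank A ≤ (k + 1) ^ k * e ^ k * k :=
    (Subgroup.rank_le_index_mul_rank A).trans (Nat.mul_le_mul hAidx hrank)
  have hAcard : Nat.card A ≤ ((k + 1) ^ k) ^ ((k + 1) ^ k * e ^ k * k) :=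
    (Nat.le_of_dvd (pow_pos hcpos _) hAdvd).trans
      ((Nat.pow_le_pow_left hc2 _).trans
        (Nat.pow_le_pow_right (pow_pos (Nat.succ_pos k) k) hArank))
  have hmul := A.card_mul_index
  have hAfin : A.FiniteIndex := inferInstance
  refine ⟨Nat.finite_of_card_ne_zero ?_, ?_⟩
  · rw [← hmul]
    exact mul_ne_zero hAcard0 hAfin.index_ne_zero
  · rw [← hmul]
    exact Nat.mul_le_mul hAcard hAidx

theorem card_closure_le {G : Type*} [Group G] {S : Set G} (hS : S.Finite)
    (hcj : ∀ d, ∀ s ∈ S, cj d s ∈ S) {k e : ℕ} (hk : S.ncard ≤ k)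
    (he : 0 < e) (hpow : ∀ s ∈ S, s ^ e = 1) :
    Finite (Subgroup.closure S) ∧ Nat.card (Subgroup.closure S) ≤ normalClosureBound k e := by
  have hinj := (Subgroup.closure S).subtype_injective
  refine card_le_of_closure_eq_top (S := (Subgroup.closure S).subtype ⁻¹' S)
    (hS.preimage hinj.injOn) ?_ ?_ ?_ he ?_
  · intro d s hs
    have := hcj d s hs
    simpa [cj_apply] using this
  · exact Subgroup.closure_closure_coe_preimage
  · rwa [Set.ncard_preimage_of_injective_subset_range hinj]
    simp
  · intro s hs
    exact Subtype.ext (hpow s hs)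

end Dietzmann

/-! ### Bounding `γ_ℓ` from a nilpotent subgroup and a bounded exponent -/

section BoundedExponent

/-- Taking `[u, z]` as a single first entry makes room for `c` at the end without increasing the
length. This needs `ℓ ≥ 2`; for `ℓ = 1` the hypothesis makes `M` trivial. -/
theorem comm₂_mem_of_lowerCentralSeries_eq_bot {G : Type*} [Group G] {M : Subgroup G} {ℓ : ℕ}
    (hℓ : 0 < ℓ) (hM : M.lowerCentralSeries (ℓ - 1) = ⊥) {x c : G}
    (hx : x ∈ commutatorsOfLength G ℓ) (hc : c ∈ M) :
    comm₂ x c ∈ commutatorsOfLength G ℓ := by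
  obtain ⟨u, g, hg, rfl⟩ := (mem_commutatorsOfLength_iff hℓ).mp hx
  cases g with
  | nil =>
    subst hg
    have hM' : M = ⊥ := hM
    rw [hM', Subgroup.mem_bot] at hc
    rw [hc, comm₂_one_right]
    exact ⟨[1], rfl, rfl⟩
  | cons z g =>
    refine (mem_commutatorsOfLength_iff hℓ).mpr ⟨comm₂ u z, g ++ [c], by simpa using hg, ?_⟩
    rw [iterComm_append]
    rfl

/-- If commutators of length `ℓ` depend only on the cosets of `D`, there are at most
`|G : D| ^ ℓ` of them. -/
theorem ncard_commutatorsOfLength_le {G : Type*} [Group G] (D : Subgroup G) [D.Normal]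
    [D.FiniteIndex] {ℓ : ℕ} (hℓ : 0 < ℓ)
    (h : ∀ (u : G) (g : List G), g.length + 1 = ℓ → ∀ c ∈ D, ∀ g', CosetEq D g' g →
      iterComm g' (u * c) = iterComm g u) :
    (commutatorsOfLength G ℓ).Finite ∧ (commutatorsOfLength G ℓ).ncard ≤ D.index ^ ℓ := by
  have hfin : Finite (G ⧸ D) := inferInstance
  let F : (Fin ℓ → G ⧸ D) → G := fun f => leftNormedComm (List.ofFn fun i => (f i).out)
  have hsub : commutatorsOfLength G ℓ ⊆ Set.range F := by
    rintro _ ⟨xs, rfl, rfl⟩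
    refine ⟨fun i => QuotientGroup.mk' D xs[i], ?_⟩
    have key : CosetEq D (List.ofFn fun i : Fin xs.length =>
        (QuotientGroup.mk' D xs[i] : G ⧸ D).out) xs := by
      unfold CosetEq
      rw [List.map_ofFn]
      conv_rhs => rw [← List.ofFn_getElem (xs := xs), List.map_ofFn]
      congr 1
      funext i
      exact Quotient.out_eq' _
    change leftNormedComm (List.ofFn fun i : Fin xs.length =>
        (QuotientGroup.mk' D xs[i] : G ⧸ D).out) = _
    generalize (List.ofFn fun i : Fin xs.length =>
        (QuotientGroup.mk' D xs[i] : G ⧸ D).out) = ys at key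
    cases xs with
    | nil => simp at hℓ
    | cons u g =>
      cases ys with
      | nil => simpa using key.length_eq
      | cons y g' =>
        obtain ⟨⟨c, hc, rfl⟩, h2⟩ := cosetEq_cons.mp key
        exact h u g rfl c hc g' h2
  have hF := Set.finite_range F
  refine ⟨hF.subset hsub, (Set.ncard_le_ncard hsub hF).trans ?_⟩
  rw [← Nat.card_coe_set_eq]
  refine (Finite.card_range_le F).trans ?_
  rw [Nat.card_fun, Nat.card_fin, Subgroup.index]

/-- The bound for the number of elements of a nilpotent subgroup of index `B` that satisfy
`g ^ e = 1`. -/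
def torsionBound (r B ℓ e : ℕ) : ℕ := e ^ seriesLength (B * r) (ℓ - 1)

/-- The bound for the index of the subgroup modulo which commutators of length `ℓ` are
well defined. -/
def cosetIndexBound (r B ℓ e : ℕ) : ℕ :=
  verbalIndexBound r (torsionBound r B ℓ e).factorial
    (verbalIndexBound r e (B * (torsionBound r B ℓ e + 1) ^ torsionBound r B ℓ e) 1)
    (chainLength ℓ)

/-- The bound for the order of `γ_ℓ(G)` when the commutators of length `ℓ` have exponent `e`
and `γ_ℓ` vanishes on a subgroup of index `B`. -/
def gammaBound (r B ℓ e : ℕ) : ℕ := normalClosureBound (cosetIndexBound r B ℓ e ^ ℓ) e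

theorem card_torsion_le {G : Type u} [Group G] {r B c e : ℕ} (hG : IsGeneratedBy G r) (he : 0 < e)
    (M : Subgroup G) [M.FiniteIndex] (hB : M.index ≤ B) (hM : M.lowerCentralSeries c = ⊥) :
    {g | g ∈ M ∧ g ^ e = 1}.Finite ∧
      {g | g ∈ M ∧ g ^ e = 1}.ncard ≤ e ^ seriesLength (B * r) c := by
  have := hG.fg
  have hrank : Group.rank M ≤ B * r :=
    (Subgroup.rank_le_index_mul_rank M).trans (Nat.mul_le_mul hB hG.rank_le)
  have hM' : (⊤ : Subgroup M).lowerCentralSeries c = ⊥ := by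
    rw [← Subgroup.map_subtype_inj, Subgroup.map_bot, Subgroup.top_subtype_lowerCentralSeries, hM]
  obtain ⟨N, hN, hser⟩ := exists_hasCentralCyclicSeries hrank hM'
  obtain ⟨h1, h2⟩ := hser.card_torsion_le he N
  have himg : {g | g ∈ M ∧ g ^ e = 1} = M.subtype '' {g : M | g ^ e = 1} := by
    ext g
    constructor
    · rintro ⟨hg, hge⟩
      exact ⟨⟨g, hg⟩, Subtype.ext hge, rfl⟩
    · rintro ⟨g, hg, rfl⟩
      exact ⟨g.2, congrArg Subtype.val hg⟩
  have hfin : {g : M | g ^ e = 1}.Finite := Set.finite_coe_iff.mp h1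
  rw [himg]
  refine ⟨hfin.image _, (Set.ncard_image_le hfin).trans ?_⟩
  rw [← Nat.card_coe_set_eq]
  exact h2.trans (Nat.pow_le_pow_right he hN)

/-- The few-values argument now runs for every commutator `x`, with `S` the set of elements of `M`
killed by `e`: the perturbation `t` is a commutator lying in `M`, so it belongs to `S` without any
condition on orders. -/
theorem card_lowerCentralSeries_le {G : Type u} [Group G] {r B ℓ e : ℕ} (hℓ : 0 < ℓ) (he : 0 < e)
    (hG : IsGeneratedBy G r) (M : Subgroup G) [M.Normal] [M.FiniteIndex] (hB : M.index ≤ B)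
    (hM : M.lowerCentralSeries (ℓ - 1) = ⊥) (hpow : ∀ x ∈ commutatorsOfLength G ℓ, x ^ e = 1) :
    Finite ((⊤ : Subgroup G).lowerCentralSeries (ℓ - 1)) ∧
      Nat.card ((⊤ : Subgroup G).lowerCentralSeries (ℓ - 1)) ≤ gammaBound r B ℓ e := by
  obtain ⟨hSfin, hScard⟩ := card_torsion_le hG he M hB hM
  set S := {g | g ∈ M ∧ g ^ e = 1} with hS
  set N := torsionBound r B ℓ e with hN
  change S.ncard ≤ N at hScard
  have hScj : ∀ d, ∀ y ∈ S, cj d y ∈ S := fun d y hy =>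
    ⟨cj_mem d hy.1, by rw [← map_pow, hy.2, map_one]⟩
  have := centralizer_normal hScj
  obtain ⟨hCfin, hCidx⟩ := centralizer_finiteIndex hScj hSfin hScard
  set D₁ := M ⊓ Subgroup.centralizer S with hD₁
  have hD₁idx : D₁.index ≤ B * (N + 1) ^ N :=
    Subgroup.index_inf_le.trans (Nat.mul_le_mul hB hCidx)
  obtain ⟨hD₀fin, hD₀idx⟩ := verbalIter_finiteIndex he hG D₁ inferInstance hD₁idx 1
  set D₀ := verbalIter e 1 D₁ with hD₀
  have hD₀D₁ : D₀ ≤ D₁ := verbalIter_le _ _ _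
  have hSD₁ : S ⊆ Subgroup.centralizer (D₁ : Set G) := fun s hs =>
    Subgroup.mem_centralizer_iff.mpr fun d hd =>
      (Subgroup.mem_centralizer_iff.mp hd.2 s hs).symm
  have hcommS : ∀ x ∈ commutatorsOfLength G ℓ, ∀ c ∈ D₁, comm₂ x c ∈ S := fun x hx c hc =>
    ⟨comm₂_mem_right x hc.1, hpow _ (comm₂_mem_of_lowerCentralSeries_eq_bot hℓ hM hx hc.1)⟩
  -- On `D₁` the map `c ↦ [x, c]` is a homomorphism into commuting elements killed by `e`, so it
  -- vanishes on `verbal e D₁`.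
  have hcent : ∀ x ∈ commutatorsOfLength G ℓ, x ∈ Subgroup.centralizer (D₀ : Set G) := by
    intro x hx
    have hcomm : ∀ a b : D₁, comm₂ x a * comm₂ x b = comm₂ x b * comm₂ x a := fun a b =>
      Subgroup.mem_centralizer_iff.mp (hSD₁ (hcommS x hx b b.2)) _ (comm₂_mem_right x a.2)
    let f : D₁ →* G := MonoidHom.mk' (fun c => comm₂ x c) fun a b => by
      rw [Subgroup.coe_mul, comm₂_mul_right,
        cj_eq_self_of_mem_centralizer b.2 (hSD₁ (hcommS x hx a a.2)), hcomm]
    refine Subgroup.mem_centralizer_iff.mpr fun c hc => ?_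
    have h1 : comm₂ x c = 1 :=
      verbal_le_ker e D₁ f hcomm (fun a => (hcommS x hx a a.2).2) hc
    have h2 : c * x * comm₂ x c = x * c := by simp [comm₂, mul_assoc]
    rw [← h2, h1, mul_one]
  have hSD₀ : S ⊆ Subgroup.centralizer (D₀ : Set G) :=
    hSD₁.trans (Subgroup.centralizer_le hD₀D₁)
  have hfew : ∀ x, x ∈ Subgroup.centralizer (D₀ : Set G) → FewCosetValues ℓ D₀ S x := by
    intro x hx D _ hD α hα v h hL1 _ hI c hc g hg
    have hxD : x ∈ Subgroup.centralizer (D : Set G) := Subgroup.centralizer_le hD hx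
    rw [iterComm_mul, cosetEq_iterComm_cj hxD hI hc hg, mul_inv_cancel_right]
    refine ⟨cj_mem _ (iterComm_mem _ (hα.mem M inferInstance c (hD₀D₁ (hD hc)).1)), hpow _ ?_⟩
    exact map_mem_commutatorsOfLength _ (hL1 c _ (by rw [length_twist, hg.length_eq]))
  set D := verbalIter N.factorial (chainLength ℓ) D₀ with hD
  obtain ⟨hDfin, hDidx⟩ := verbalIter_finiteIndex (Nat.factorial_pos N) hG D₀ hD₀fin hD₀idx
    (chainLength ℓ)
  obtain ⟨hLfin, hLcard⟩ := ncard_commutatorsOfLength_le D hℓ (by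
    rintro u g rfl c hc g' hg'
    have hx := hcent _ (iterComm_mem_commutatorsOfLength g u)
    exact (coset_chain N hSfin hScard hSD₀ u g hx (hfew _ hx)).1 c hc g' hg')
  rw [lowerCentralSeries_eq_closure hℓ]
  exact card_closure_le hLfin (fun d s hs => map_mem_commutatorsOfLength _ hs)
    (hLcard.trans (Nat.pow_le_pow_left hDidx ℓ)) he hpow

/-- The index bound in the case covered by `OrderAlternative`. -/
def alternativeIndexBound (m ℓ r : ℕ) : ℕ :=
  verbalIndexBound r (3 * m).factorial ((m + 1) ^ m) (chainLength ℓ)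

/-- The order bound in the case covered by `OrderAlternative`. -/
def alternativeGammaBound (m ℓ r : ℕ) : ℕ :=
  gammaBound r (alternativeIndexBound m ℓ r) ℓ (2 * m).factorial.factorial

theorem card_lowerCentralSeries_le_of_orderAlternative {G : Type u} [Group G] {ℓ m n r : ℕ}
    (hℓ : 0 < ℓ) (hn : 0 < n) (hG : IsGeneratedBy G r) (hmax : IsMaximalCommutatorOrder G ℓ n)
    (hfin : (commutatorsOfOrder G ℓ n).Finite) (hm : (commutatorsOfOrder G ℓ n).ncard ≤ m)
    (halt : OrderAlternative G n) :
    Finite ((⊤ : Subgroup G).lowerCentralSeries (ℓ - 1)) ∧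
      Nat.card ((⊤ : Subgroup G).lowerCentralSeries (ℓ - 1)) ≤ alternativeGammaBound m ℓ r := by
  obtain ⟨M, hM, hMfin, hMidx, hMγ⟩ := exists_normal_gamma_eq_bot hℓ hG hmax hfin hm halt
  have := hG.fg
  have := Subgroup.isNilpotent_of_lowerCentralSeries_eq_bot hMγ
  have hdvd := dvd_factorial_of_totient_le hn
    ((totient_le_ncard_commutatorsOfOrder M hℓ hn hmax hfin).trans hm)
  have hle := Nat.le_of_dvd (Nat.factorial_pos _) hdvd
  -- All orders are at most `n ≤ (2m)!`, though they need not divide `n`. The second factorial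
  -- provides a common exponent.
  refine card_lowerCentralSeries_le hℓ (Nat.factorial_pos _) hG M hMidx hMγ fun x hx => ?_
  obtain ⟨h1, h2⟩ := hmax.1 x hx
  exact orderOf_dvd_iff_pow_eq_one.mp (Nat.dvd_factorial h1.orderOf_pos (h2.trans hle))

end BoundedExponent

/-! ### Passing to quotients and products -/

section Transfer

theorem map_leftNormedComm {G K : Type*} [Group G] [Group K] (f : G →* K) (xs : List G) :
    f (leftNormedComm xs) = leftNormedComm (xs.map f) := by
  cases xs with
  | nil => exact map_one f
  | cons u g => rw [List.map_cons, leftNormedComm_cons, leftNormedComm_cons, map_iterComm]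

theorem isMaximalCommutatorOrder_of_surjective {G K : Type*} [Group G] [Group K] (f : G →* K)
    (hf : Function.Surjective f) {ℓ m n : ℕ} (hmax : IsMaximalCommutatorOrder G ℓ n)
    (hfin : (commutatorsOfOrder G ℓ n).Finite) (hm : (commutatorsOfOrder G ℓ n).ncard ≤ m)
    {x : G} (hx : x ∈ commutatorsOfLength G ℓ) (hfx : orderOf (f x) = n) :
    IsMaximalCommutatorOrder K ℓ n ∧ (commutatorsOfOrder K ℓ n).Finite ∧
      (commutatorsOfOrder K ℓ n).ncard ≤ m := by
  have hsub : commutatorsOfOrder K ℓ n ⊆ f '' commutatorsOfOrder G ℓ n := by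
    rintro y ⟨hy, hyn⟩
    obtain ⟨z, hz, rfl⟩ := exists_of_mem_commutatorsOfLength f hf hy
    exact ⟨z, ⟨hz, orderOf_eq_of_dvd (hmax.1 z hz) (hyn ▸ orderOf_map_dvd f z)⟩, rfl⟩
  have hfin' := hfin.image f
  refine ⟨⟨fun y hy => ?_, f x, map_mem_commutatorsOfLength f hx, hfx⟩, hfin'.subset hsub,
    (Set.ncard_le_ncard hsub hfin').trans ((Set.ncard_image_le hfin).trans hm)⟩
  obtain ⟨z, hz, rfl⟩ := exists_of_mem_commutatorsOfLength f hf hy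
  obtain ⟨h1, h2⟩ := hmax.1 z hz
  have h3 := orderOf_map_dvd f z
  exact ⟨orderOf_pos_iff.mp (Nat.pos_of_dvd_of_pos h3 h1.orderOf_pos),
    (Nat.le_of_dvd h1.orderOf_pos h3).trans h2⟩

theorem mem_commutatorsOfLength_pi {η : Type*} {Gs : η → Type*} [∀ i, Group (Gs i)] {ℓ : ℕ}
    {y : ∀ i, Gs i} (h : ∀ i, y i ∈ commutatorsOfLength (Gs i) ℓ) :
    y ∈ commutatorsOfLength (∀ i, Gs i) ℓ := by
  choose xs hlen hxs using h
  refine ⟨List.ofFn fun (k : Fin ℓ) i => (xs i)[k]'(by rw [hlen]; exact k.2), by simp, ?_⟩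
  funext i
  have h1 := map_leftNormedComm (Pi.evalMonoidHom Gs i)
    (List.ofFn fun (k : Fin ℓ) i => (xs i)[k]'(by rw [hlen]; exact k.2))
  rw [Pi.evalMonoidHom_apply] at h1
  rw [h1, ← hxs, List.map_ofFn]
  congr 1
  refine List.ext_getElem (by simp [hlen]) fun k _ _ => ?_
  simp

end Transfer

/-! ### Direct products of `p`-groups for distinct primes -/

section CoprimeProduct

theorem prod_le_pow_self {η : Type*} [Fintype η] {F : ℕ} (hF : 0 < F) (π : η → ℕ)
    (hπ : Function.Injective π) (hpos : ∀ i, 0 < π i) (a : η → ℕ) (ha : ∀ i, a i ≤ F) (ha' : ∀ i, F < π i → a i = 1) :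
    ∏ i, a i ≤ F ^ F := by
  classical
  rw [← Finset.prod_filter_mul_prod_filter_not Finset.univ (fun i => π i ≤ F)]
  have h1 : ∏ i ∈ Finset.univ.filter (fun i => ¬ π i ≤ F), a i = 1 :=
    Finset.prod_eq_one fun i hi => ha' i (by simpa using hi)
  rw [h1, mul_one]
  refine (Finset.prod_le_pow_card _ _ _ fun i _ => ha i).trans (Nat.pow_le_pow_right hF ?_)
  have h2 : ((Finset.univ.filter fun i => π i ≤ F).image π) ⊆ Finset.Icc 1 F := by
    intro k hk
    simp only [Finset.mem_image, Finset.mem_filter, Finset.mem_univ, true_and] at hk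
    obtain ⟨i, hi, rfl⟩ := hk
    exact Finset.mem_Icc.mpr ⟨hpos i, hi⟩
  have h3 := Finset.card_le_card h2
  rwa [Finset.card_image_of_injective _ hπ, Nat.card_Icc, Nat.add_sub_cancel] at h3

variable {η : Type*} [Fintype η] {Gs : η → Type u} [∀ i, Group (Gs i)]

theorem orderOf_update [DecidableEq η]
    (hcop : Pairwise fun i j => (Nat.card (Gs i)).Coprime (Nat.card (Gs j)))
    (x : ∀ i, Gs i) (i : η) (z : Gs i) :
    orderOf (Function.update x i z) = orderOf z * orderOf (Function.update x i 1) := by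
  have h1 : Function.update x i z = Pi.mulSingle i z * Function.update x i 1 := by
    funext j
    rcases eq_or_ne j i with rfl | hj
    · simp
    · simp [hj]
  have hcomm : Commute (Pi.mulSingle i z) (Function.update x i 1) := by
    funext j
    rcases eq_or_ne j i with rfl | hj
    · simp
    · simp [hj]
  have h2 : orderOf (Pi.mulSingle i z) = orderOf z :=
    orderOf_injective (MonoidHom.mulSingle Gs i) (Pi.mulSingle_injective i) z
  have h3 : orderOf (Function.update x i 1) ∣ ∏ j ∈ Finset.univ.erase i, Nat.card (Gs j) := by
    refine orderOf_dvd_of_pow_eq_one ?_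
    funext j
    rw [Pi.pow_apply, Pi.one_apply]
    rcases eq_or_ne j i with rfl | hj
    · simp
    · rw [Function.update_of_ne hj]
      exact orderOf_dvd_iff_pow_eq_one.mp ((orderOf_dvd_natCard _).trans
        (Finset.dvd_prod_of_mem _ (Finset.mem_erase.mpr ⟨hj, Finset.mem_univ j⟩)))
  rw [h1, hcomm.orderOf_mul_eq_mul_orderOf_of_coprime, h2]
  rw [h2]
  refine Nat.Coprime.of_dvd (orderOf_dvd_natCard z) h3 (Nat.Coprime.prod_right fun j hj => ?_)
  exact hcop (Finset.ne_of_mem_erase hj).symm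

/-- Only the `i`-th coordinate of a maximal `x` is varied. By coprimality the order is the product
of the order of that coordinate and a fixed factor, so maximality and the count `m` both pass to the
`i`-th factor. -/
theorem isMaximalCommutatorOrder_of_pi [DecidableEq η] [∀ i, Finite (Gs i)]
    (hcop : Pairwise fun i j => (Nat.card (Gs i)).Coprime (Nat.card (Gs j))) {ℓ m n : ℕ}
    (hmax : IsMaximalCommutatorOrder (∀ i, Gs i) ℓ n)
    (hm : (commutatorsOfOrder (∀ i, Gs i) ℓ n).ncard ≤ m) (i : η) :
    ∃ k, IsMaximalCommutatorOrder (Gs i) ℓ k ∧ (commutatorsOfOrder (Gs i) ℓ k).ncard ≤ m := by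
  obtain ⟨x, hx, hxn⟩ := hmax.2
  have hxi : ∀ j, x j ∈ commutatorsOfLength (Gs j) ℓ := fun j =>
    map_mem_commutatorsOfLength (Pi.evalMonoidHom Gs j) hx
  have hupd : ∀ z ∈ commutatorsOfLength (Gs i) ℓ,
      Function.update x i z ∈ commutatorsOfLength (∀ i, Gs i) ℓ := by
    intro z hz
    refine mem_commutatorsOfLength_pi fun j => ?_
    rcases eq_or_ne j i with rfl | hj
    · simpa using hz
    · simpa [hj] using hxi j
  have hxn' : n = orderOf (x i) * orderOf (Function.update x i 1) := by
    rw [← orderOf_update hcop, Function.update_eq_self, hxn]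
  refine ⟨orderOf (x i), ⟨fun z hz => ⟨isOfFinOrder_of_finite z, ?_⟩, x i, hxi i, rfl⟩, ?_⟩
  · have h1 := (hmax.1 _ (hupd z hz)).2
    rw [orderOf_update hcop, hxn'] at h1
    exact Nat.le_of_mul_le_mul_right h1 (orderOf_pos _)
  · refine (Set.ncard_le_ncard_of_injOn (Function.update x i) ?_
      (Function.update_injective x i).injOn (Set.toFinite _)).trans hm
    rintro z ⟨hz, hzn⟩
    exact ⟨hupd z hz, by rw [orderOf_update hcop, hzn, hxn']⟩

theorem card_lowerCentralSeries_pi_le [∀ i, Finite (Gs i)] (c : ℕ) :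
    Nat.card ((⊤ : Subgroup (∀ i, Gs i)).lowerCentralSeries c) ≤
      ∏ i, Nat.card ((⊤ : Subgroup (Gs i)).lowerCentralSeries c) := by
  rw [← Nat.card_pi]
  refine Nat.card_le_card_of_injective (fun y i => ⟨y.1 i, ?_⟩) fun y z h => ?_
  · exact Subgroup.top_lowerCentralSeries_pi_le c y.2 i (Set.mem_univ i)
  · exact Subtype.ext (funext fun i => congrArg Subtype.val (congrFun h i))

/-- Each factor falls under the prime-power case. If its prime exceeds the resulting bound, `γ_ℓ` of
the factor is a group of `p`-power order less than `p`, hence trivial. The `+ 1` keeps the base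
positive in `prod_le_pow_self`. -/
theorem card_lowerCentralSeries_pi_pGroups_le [∀ i, Finite (Gs i)] {π : η → ℕ} (hπ : Function.Injective π)
    (hprime : ∀ i, (π i).Prime) (hGs : ∀ i, IsPGroup (π i) (Gs i)) {ℓ m n r : ℕ} (hℓ : 0 < ℓ)
    (hG : IsGeneratedBy (∀ i, Gs i) r) (hmax : IsMaximalCommutatorOrder (∀ i, Gs i) ℓ n)
    (hm : (commutatorsOfOrder (∀ i, Gs i) ℓ n).ncard ≤ m) :
    Nat.card ((⊤ : Subgroup (∀ i, Gs i)).lowerCentralSeries (ℓ - 1)) ≤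
      (alternativeGammaBound m ℓ r + 1) ^ (alternativeGammaBound m ℓ r + 1) := by
  classical
  have hfact : ∀ i, Fact (π i).Prime := fun i => ⟨hprime i⟩
  have hcop : Pairwise fun i j => (Nat.card (Gs i)).Coprime (Nat.card (Gs j)) := by
    intro i j hij
    obtain ⟨a, ha⟩ := IsPGroup.iff_card.mp (hGs i)
    obtain ⟨b, hb⟩ := IsPGroup.iff_card.mp (hGs j)
    rw [ha, hb]
    exact Nat.coprime_pow_primes _ _ (hprime i) (hprime j) (hπ.ne hij)
  have hbound : ∀ i, Nat.card ((⊤ : Subgroup (Gs i)).lowerCentralSeries (ℓ - 1)) ≤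
      alternativeGammaBound m ℓ r := by
    intro i
    obtain ⟨k, hk, hkm⟩ := isMaximalCommutatorOrder_of_pi hcop hmax hm i
    obtain ⟨z, _, hz⟩ := hk.2
    obtain ⟨a, ha⟩ := IsPGroup.iff_orderOf.mp (hGs i) z
    have hk' : k = π i ^ a := by rw [← hz, ha]
    refine (card_lowerCentralSeries_le_of_orderAlternative hℓ
      (hk' ▸ pow_pos (hprime i).pos a) (hG.of_surjective (Pi.evalMonoidHom Gs i)
        (Function.surjective_eval i)) hk (Set.toFinite _) hkm ?_).2
    rw [hk']
    exact orderAlternative_prime_pow (hprime i)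
  refine (card_lowerCentralSeries_pi_le _).trans (prod_le_pow_self (Nat.succ_pos _) π hπ
    (fun i => (hprime i).pos) _ (fun i => (hbound i).trans (Nat.le_succ _)) fun i hi => ?_)
  obtain ⟨a, ha⟩ := IsPGroup.iff_card.mp
    ((hGs i).to_subgroup ((⊤ : Subgroup (Gs i)).lowerCentralSeries (ℓ - 1)))
  rcases Nat.eq_zero_or_pos a with rfl | hpos
  · rw [ha, pow_zero]
  · have h1 := hbound i
    rw [ha] at h1
    have h2 := Nat.le_self_pow hpos.ne' (π i)
    omega

end CoprimeProduct

/-! ### Nilpotent groups, and recovering a subgroup of bounded index -/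

section Nilpotent

theorem isPGroup_pi {η : Type*} [Finite η] {Gs : η → Type*} [∀ i, Group (Gs i)] {p : ℕ}
    (h : ∀ i, IsPGroup p (Gs i)) : IsPGroup p (∀ i, Gs i) := by
  have := Fintype.ofFinite η
  intro x
  choose k hk using fun i => h i (x i)
  refine ⟨∑ i, k i, funext fun i => ?_⟩
  rw [Pi.pow_apply, Pi.one_apply]
  have h1 : p ^ k i ∣ p ^ ∑ i, k i :=
    pow_dvd_pow p (Finset.single_le_sum (fun _ _ => Nat.zero_le _) (Finset.mem_univ i))
  obtain ⟨b, hb⟩ := h1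
  rw [hb, pow_mul, hk, one_pow]

/-- The order bound in the nilpotent case. -/
def nilpotentGammaBound (m ℓ r : ℕ) : ℕ :=
  (alternativeGammaBound m ℓ r + 1) ^ (alternativeGammaBound m ℓ r + 1)

theorem card_lowerCentralSeries_le_of_finite {G : Type u} [Group G] [Finite G]
    [hnil : Group.IsNilpotent G] {ℓ m n r : ℕ} (hℓ : 0 < ℓ) (hG : IsGeneratedBy G r)
    (hmax : IsMaximalCommutatorOrder G ℓ n) (hm : (commutatorsOfOrder G ℓ n).ncard ≤ m) :
    Nat.card ((⊤ : Subgroup G).lowerCentralSeries (ℓ - 1)) ≤ nilpotentGammaBound m ℓ r := by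
  obtain ⟨e⟩ := ((Group.isNilpotent_of_finite_tfae (G := G)).out 0 4).mp hnil
  obtain ⟨x, hx, hxn⟩ := hmax.2
  have hxe : orderOf (e.symm x) = n := by
    rw [← hxn]
    exact orderOf_injective e.symm.toMonoidHom e.symm.injective x
  obtain ⟨h1, h2, h3⟩ := isMaximalCommutatorOrder_of_surjective e.symm.toMonoidHom
    e.symm.surjective hmax (Set.toFinite _) hm hx hxe
  have h4 := card_lowerCentralSeries_pi_pGroups_le
    (η := (Nat.card G).primeFactors) (π := Subtype.val) Subtype.val_injective
    (fun p => Nat.prime_of_mem_primeFactors p.2) (fun p => isPGroup_pi fun P => P.isPGroup') hℓ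
    (hG.of_surjective e.symm.toMonoidHom e.symm.surjective) h1 h3
  refine le_trans (le_of_eq ?_) h4
  have h5 : ((⊤ : Subgroup G).lowerCentralSeries (ℓ - 1)).map e.symm.toMonoidHom =
      (⊤ : Subgroup _).lowerCentralSeries (ℓ - 1) := by
    rw [Subgroup.map_lowerCentralSeries, Subgroup.map_top_of_surjective _ e.symm.surjective]
  rw [← h5]
  exact (Subgroup.card_map_of_injective e.symm.injective).symm

theorem card_lowerCentralSeries_le_of_isNilpotent {G : Type u} [Group G]
    [hnil : Group.IsNilpotent G] {ℓ m n r : ℕ} (hℓ : 0 < ℓ) (hn : 0 < n) (hG : IsGeneratedBy G r)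
    (hmax : IsMaximalCommutatorOrder G ℓ n) (hfin : (commutatorsOfOrder G ℓ n).Finite)
    (hm : (commutatorsOfOrder G ℓ n).ncard ≤ m) :
    Finite ((⊤ : Subgroup G).lowerCentralSeries (ℓ - 1)) ∧
      Nat.card ((⊤ : Subgroup G).lowerCentralSeries (ℓ - 1)) ≤ nilpotentGammaBound m ℓ r := by
  have := hG.fg
  have : Group.IsNilpotent (⊤ : Subgroup G) := inferInstance
  obtain ⟨x, hx, hxn⟩ := hmax.2
  have key : ∀ T : Finset G, (T : Set G) ⊆ (⊤ : Subgroup G).lowerCentralSeries (ℓ - 1) →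
      T.card ≤ nilpotentGammaBound m ℓ r := by
    intro T hT
    -- The finite quotient must preserve the order of `x`, so that the hypotheses descend, and
    -- separate the points of `T`, so that the bound lifts back.
    obtain ⟨N, hN, hNfin, hS⟩ := exists_finiteIndex_disjoint (⊤ : Subgroup G)
      (((Finset.finite_toSet (Finset.range n)).image fun k => x ^ k).union
        (Set.Finite.image2 (fun a b : G => a⁻¹ * b) T.finite_toSet T.finite_toSet))
    have hsurj := QuotientGroup.mk'_surjective N
    have hord := orderOf_mk'_eq (N := N) hn hxn fun k hk =>
      hS (x ^ k) (Or.inl ⟨k, by simpa using hk, rfl⟩)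
    obtain ⟨h1, _, h3⟩ := isMaximalCommutatorOrder_of_surjective (QuotientGroup.mk' N) hsurj hmax
      hfin hm hx hord
    refine le_trans ?_ (card_lowerCentralSeries_le_of_finite hℓ
      (hG.of_surjective (QuotientGroup.mk' N) hsurj) h1 h3)
    rw [← Subgroup.map_top_of_surjective _ hsurj, ← Subgroup.map_lowerCentralSeries,
      ← Set.ncard_coe_finset]
    refine (Set.ncard_le_ncard_of_injOn (QuotientGroup.mk' N)
      (fun a ha => Subgroup.mem_map_of_mem _ (hT ha)) (fun a ha b hb hab => ?_)
      (Set.toFinite _)).trans (Nat.card_coe_set_eq _).ge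
    by_contra hne
    refine hS (a⁻¹ * b) (Or.inr ⟨a, ha, b, hb, rfl⟩) (fun h => hne ?_) (QuotientGroup.eq.mp hab)
    exact inv_mul_eq_one.mp h
  have hΓ : ((⊤ : Subgroup G).lowerCentralSeries (ℓ - 1) : Set G).Finite := by
    by_contra hinf
    obtain ⟨T, hT, hTcard⟩ := Set.Infinite.exists_subset_card_eq hinf
      (nilpotentGammaBound m ℓ r + 1)
    have := key T hT
    omega
  refine ⟨hΓ, ?_⟩
  have h1 := key hΓ.toFinset (by simp)
  rw [← Set.ncard_eq_toFinset_card _ hΓ, ← Nat.card_coe_set_eq] at h1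
  exact h1

/-- If `γ_ℓ(G)` is finite, a subgroup of bounded index has trivial `γ_ℓ`. -/
theorem exists_gamma_eq_bot_of_card_le {G : Type*} [Group G] {ℓ r F : ℕ} (hℓ : 0 < ℓ)
    (hG : IsGeneratedBy G r) [hfin : Finite ((⊤ : Subgroup G).lowerCentralSeries (ℓ - 1))]
    (hF : Nat.card ((⊤ : Subgroup G).lowerCentralSeries (ℓ - 1)) ≤ F) :
    ∃ M : Subgroup G, M.FiniteIndex ∧
      M.index ≤ verbalIndexBound r F.factorial ((F + 1) ^ F) ℓ ∧
      M.lowerCentralSeries (ℓ - 1) = ⊥ := by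
  set S : Set G := SetLike.coe ((⊤ : Subgroup G).lowerCentralSeries (ℓ - 1)) with hS
  have hSfin : S.Finite := hfin
  have hScard : S.ncard ≤ F := by rwa [← Nat.card_coe_set_eq]
  have hScj : ∀ d, ∀ y ∈ S, cj d y ∈ S := fun d y hy => cj_mem d hy
  have := centralizer_normal hScj
  obtain ⟨h1, h2⟩ := centralizer_finiteIndex hScj hSfin hScard
  have hSc : S ⊆ Subgroup.centralizer (Subgroup.centralizer S : Set G) := fun s hs =>
    Subgroup.mem_centralizer_iff.mpr fun d hd => (Subgroup.mem_centralizer_iff.mp hd s hs).symm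
  -- With trivial entries and `v = x = 1`, the cosets in `coset_step` are `D` itself and all values
  -- lie in `γ_ℓ(G)`. After `ℓ` verbal steps every commutator of length `ℓ` with entries in the
  -- smaller subgroup is trivial.
  set h := List.replicate (ℓ - 1) (1 : G) with hh
  have hlen : h.length = ℓ - 1 := List.length_replicate
  have hstep := (coset_step F hSfin hScard hSc isCrossed_id (v := 1) (x := 1) (h := h)
    (Subgroup.one_mem _) (fun g _ => iterComm_one g) fun c _ g hg => by
      rw [map_one, mul_one, inv_one, mul_one, hS, SetLike.mem_coe, lowerCentralSeries_eq_closure hℓ]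
      refine Subgroup.subset_closure ((mem_commutatorsOfLength_iff hℓ).mpr ⟨c, g, ?_, rfl⟩)
      rw [hg.length_eq, hlen]
      omega).2
  obtain ⟨h3, h4⟩ := verbalIter_finiteIndex (Nat.factorial_pos F) hG _ h1 h2 (h.length + 1)
  have h5 := lowerCentralSeries_eq_bot_of_iterComm (twist 1 h) hstep
  rw [hlen, Nat.sub_add_cancel hℓ] at h3 h4
  rw [length_twist, hlen, Nat.sub_add_cancel hℓ] at h5
  exact ⟨_, h3, h4, h5⟩

end Nilpotent

end MaxOrderCommutators

/-! ### Assembly of the three cases -/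

theorem theorem1p2 :
    ∃ f g : ℕ → ℕ → ℕ → ℕ, ∀ (ℓ m n r : ℕ), 0 < ℓ → 0 < m → 0 < n → 0 < r →
      ∀ (G : Type*) [Group G],
        MaxOrderCommutators.IsGeneratedBy G r →
        MaxOrderCommutators.IsMaximalCommutatorOrder G ℓ n →
        (MaxOrderCommutators.commutatorsOfOrder G ℓ n).Finite →
        (MaxOrderCommutators.commutatorsOfOrder G ℓ n).ncard ≤ m →
        ((∃ p α : ℕ, p.Prime ∧ n = p ^ α) ∨
          (∃ p q α β : ℕ, p.Prime ∧ q.Prime ∧ Odd p ∧ Odd q ∧ 0 < α ∧ 0 < β ∧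
            n = p ^ α * q ^ β) ∨
          Group.IsNilpotent G) →
        (Finite (MaxOrderCommutators.gamma ℓ (⊤ : Subgroup G)) ∧
          Nat.card (MaxOrderCommutators.gamma ℓ (⊤ : Subgroup G)) ≤ f m ℓ r) ∧
        ∃ M : Subgroup G, M.FiniteIndex ∧ M.index ≤ g m ℓ r ∧
          MaxOrderCommutators.gamma ℓ M = ⊥ := by
  refine ⟨fun m ℓ r => MaxOrderCommutators.nilpotentGammaBound m ℓ r, fun m ℓ r =>
    MaxOrderCommutators.verbalIndexBound r
      (MaxOrderCommutators.nilpotentGammaBound m ℓ r).factorial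
      ((MaxOrderCommutators.nilpotentGammaBound m ℓ r + 1) ^
        MaxOrderCommutators.nilpotentGammaBound m ℓ r) ℓ, ?_⟩
  intro ℓ m n r hℓ _ hn _ G _ hG hmax hfin hm hcase
  suffices hΓ : Finite (MaxOrderCommutators.gamma ℓ (⊤ : Subgroup G)) ∧
      Nat.card (MaxOrderCommutators.gamma ℓ (⊤ : Subgroup G)) ≤
        MaxOrderCommutators.nilpotentGammaBound m ℓ r by
    have := hΓ.1
    exact ⟨hΓ, MaxOrderCommutators.exists_gamma_eq_bot_of_card_le (hfin := hΓ.1) hℓ hG hΓ.2⟩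
  have halt : MaxOrderCommutators.OrderAlternative G n →
      Finite (MaxOrderCommutators.gamma ℓ (⊤ : Subgroup G)) ∧
        Nat.card (MaxOrderCommutators.gamma ℓ (⊤ : Subgroup G)) ≤
          MaxOrderCommutators.nilpotentGammaBound m ℓ r := fun h => by
    obtain ⟨h1, h2⟩ := MaxOrderCommutators.card_lowerCentralSeries_le_of_orderAlternative hℓ hn hG
      hmax hfin hm h
    exact ⟨h1, h2.trans ((Nat.le_succ _).trans (Nat.le_self_pow (Nat.succ_ne_zero _) _))⟩
  rcases hcase with ⟨p, α, hp, rfl⟩ | ⟨p, q, α, β, hp, hq, hpo, hqo, _, _, rfl⟩ | hnil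
  · exact halt (MaxOrderCommutators.orderAlternative_prime_pow hp)
  -- The two primes may coincide, in which case `n` is a prime power.
  · rcases eq_or_ne p q with rfl | hpq
    · rw [← pow_add] at halt
      exact halt (MaxOrderCommutators.orderAlternative_prime_pow hp)
    · exact halt (MaxOrderCommutators.orderAlternative_two_primes hp hq hpo hqo hpq)
  · exact MaxOrderCommutators.card_lowerCentralSeries_le_of_isNilpotent hℓ hn hG hmax hfin hm
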